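/- **Setting.** Let $\mathcal X$ be a measurable space and $\mathcal Y$ a finite set with $|\mathcal Y| = c$. Let $\mathsf L\colon \mathcal Y\times\mathcal Y\to[0,\infty)$ be a definite loss, i.e. $\mathsf L(y,y')=0$ iff $y=y'$, and put $M=\max_{y,y'}\mathsf L(y,y')$. Let $\mathcal D$ be a probability distribution on $\mathcal X\times\mathcal Y$, let $m\ge 1$, and let $S=((x_1,y_1),\dots,(x_m,y_m))\sim\mathcal D^m$. Every example $z\in\mathcal X\times\mathcal Y$ has a factor graph $G(z)$ with a finite set $F_z$ of factors; each factor $f$ is joined to a set $\mathcal N(f)$ of substructures. We write $\mathcal Y_f=\prod_{k\in \mathcal N(f)}\mathcal Y_k$, where $\mathcal Y_k$ is the finite set of labels of the $k$-th substructure, and $y_f\in\mathcal Y_f$ for the restriction of $y \in \mathcal Y$. Scoring functions are functions $h\colon\mathcal X\times\mathcal Y\to\mathbb R$ given together with a decomposition $h(x,y')=\sum_{f\in F_z}h_f(x,y'_f)$ for all $z=(x,y)$ and all $y'\in\mathcal Y$ (the components $h_f$ may depend on $z$). For a set $H$ of scoring functions, with $F_i=F_{(x_i,y_i)}$, let $$\widehat{\mathfrak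 R}^G_S(H)=\frac1m\,\mathbb E_{\epsilon}\Big[\sup_{h\in H}\sum_{i=1}^m\sum_{f\in F_i}\sum_{y\in\mathcal Y_f}\sqrt{|F_i|}\,\epsilon_{i,f,y}\,h_f(x_i,y)\Big],\qquad \mathfrak R^G_m(H)=\mathbb E_{S\sim\mathcal D^m}\big[\widehat{\mathfrak R}^G_S(H)\big]\in[0,\infty],$$ where the $\epsilon_{i,f,y}$ are independent and uniform on $\{\pm1\}$. For a score $f\colon\mathcal X\times\mathcal Y\to\mathbb R$ let $\mathsf f(x)\in\arg\max_y f(x,y)$ be a measurable predictor (ties broken in any measurable way) and $R(f)=\mathbb E_{(x,y)\sim\mathcal D}[\mathsf L(\mathsf f(x),y)]$. With $\Phi(r)=\min(M,\max(0,r))$ and $\tau \ge 0$ let $$\widehat R^{\rm add}_{S,\rho,\tau}(f)=\frac1m\sum_{i=1}^m\Phi\Big(\max_{y'\ne y_i}\ \mathsf L(y',y_i)+\tau-\tfrac1\rho[f(x_i,y_i)-f(x_i,y')]\Big),$$ $$\widehat R^{\rm mult}_{S,\rho,\tau}(f)=\frac1m\sum_{i=1}^m\Phi\Big(\max_{y'\ne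 y_i}\ \mathsf L(y',y_i)\big(1+\tau-\tfrac1\rho[f(x_i,y_i)-f(x_i,y')]\big)\Big).$$ Let $H_1,\dots,H_p$ be families of scoring functions whose scores satisfy $|h(x,y)-h(x,y')|\le1$ for all $x,y,y'$ (for instance, scores with values in $[0,1]$). Assume the usual measurability: each $h(\cdot,y)$ is measurable, each $H_k$ has a countable subfamily such that every score of $H_k$ is the pointwise limit of a sequence of scores from that subfamily, and $S\mapsto\widehat{\mathfrak R}^G_S(H_k)$ is measurable up to $\mathcal D^m$-null sets. Let $\mathcal F=\mathrm{conv}(\bigcup_k H_k)$ be the set of all $f=\sum_{t=1}^T\alpha_th_t$ with $T \ge 1$, $\alpha_t\ge0$, $\sum_t\alpha_t=1$, $h_t\in H_{k_t}$. **Theorem.** Fix $\rho>0$. For any $\delta>0$, with probability at least $1-\delta$ over the draw of $S\sim\mathcal D^m$, both of the following inequalities hold for all $f=\sum_{t=1}^T\alpha_th_t\in\mathcal F$ (for every such representation and every measurable predictor $\mathsf f$): $$R(f)-\widehat R^{\rm add}_{S,\rho,1}(f)\le\frac{4\sqrt2}{\rho}\sum_{t=1}^T\alpha_t\,\mathfrak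 R^G_m(H_{k_t})+C(\rho,M,c,m,p),$$ $$R(f)-\widehat R^{\rm mult}_{S,\rho,1}(f)\le\frac{4\sqrt2\,M}{\rho}\sum_{t=1}^T\alpha_t\,\mathfrak R^G_m(H_{k_t})+C(\rho,M,c,m,p),$$ where $$C(\rho,M,c,m,p)=\frac{2M}{\rho}\sqrt{\frac{\log p}{m}}+3M\sqrt{\Big\lceil\frac4{\rho^2}\log\Big(\frac{c^2\rho^2m}{4\log p}\Big)\Big\rceil\frac{\log p}{m}+\frac{\log\frac2\delta}{2m}}.$$ Here the product $\lceil\cdot\rceil\frac{\log p}{m}$ is read as $0$ when $p=1$, the square root of a negative number is read as $0$, and $0\cdot\infty=0$. -/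

import Mathlib

open MeasureTheory Filter Topology
open scoped ENNReal

noncomputable section

namespace VRM

universe u v

/-- A factor graph `(V, F, E)` with variable nodes `V = {1, …, l}`. The edges are recorded by the
neighbourhoods `N(f) ⊆ V` of the factor nodes `f`. -/
structure FactorGraph where
  l : ℕ
  Factor : Type
  [fintypeFactor : Fintype Factor]
  nbhd : Factor → Finset (Fin l)

attribute [instance] FactorGraph.fintypeFactor

/-- A factor graph together with the decomposition of the outputs along its variable nodes:
`Label k` is the finite set `Y_k` of labels of the `k`-th substructure and `part y k` is the `k`-th
substructure of `y`. When `Y = Y_1 × ⋯ × Y_l`, the map `part` is the identity; an arbitrary map is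
allowed, so that substructures may overlap and their number may vary with the example. -/
structure OutputGraph (Y : Type v) extends FactorGraph where
  Label : Fin l → Type
  [fintypeLabel : ∀ k, Fintype (Label k)]
  part : Y → ∀ k, Label k

attribute [instance] OutputGraph.fintypeLabel

/-- `Y_f`, the product of the label sets `Y_k` over the neighbours `k` of the factor `f`. -/
abbrev OutputGraph.FactorLabel {Y : Type v} (G : OutputGraph Y) (f : G.Factor) : Type :=
  ∀ k : {k // k ∈ G.nbhd f}, G.Label k

/-- `y_f`, the restriction of the output `y` to the neighbours of the factor `f`. -/
def OutputGraph.restrict {Y : Type v} (G : OutputGraph Y) (f : G.Factor) (y : Y) :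
    G.FactorLabel f :=
  fun k => G.part y k

/-- A scoring function `h : X × Y → ℝ` with its decomposition along the factor graphs `G z`, which
may depend on the example `z = (x, y)`: `h(x, y') = ∑_{f ∈ F_z} h_f(x, y'_f)` for every output
`y'`. -/
structure ScoringFunction {X : Type u} {Y : Type v} (G : X × Y → OutputGraph Y) where
  score : X → Y → ℝ
  factor : ∀ (z : X × Y) (f : (G z).Factor), (G z).FactorLabel f → ℝ
  score_eq : ∀ (z : X × Y) (y' : Y),
    score z.1 y' = ∑ f : (G z).Factor, factor z f ((G z).restrict f y')

/-- The indices `(i, f, y)` with `i ∈ [m]`, `f ∈ F_i`, `y ∈ Y_f` of the Rademacher variables. -/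
abbrev SignIndex {X : Type u} {Y : Type v} (G : X × Y → OutputGraph Y) {m : ℕ}
    (S : Fin m → X × Y) : Type :=
  Σ i : Fin m, Σ f : (G (S i)).Factor, (G (S i)).FactorLabel f

/-- `∑_i ∑_{f ∈ F_i} ∑_{y ∈ Y_f} √|F_i| ε_{i,f,y} h_f(x_i, y)`. -/
def signedSum {X : Type u} {Y : Type v} {G : X × Y → OutputGraph Y} {m : ℕ}
    (S : Fin m → X × Y) (ε : SignIndex G S → ℤˣ) (h : ScoringFunction G) : ℝ :=
  ∑ i : Fin m, ∑ f : (G (S i)).Factor, ∑ y : (G (S i)).FactorLabel f,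
    √(Fintype.card (G (S i)).Factor : ℝ) * ((ε ⟨i, f, y⟩ : ℤ) : ℝ) * h.factor (S i) f y

open Classical in
/-- The empirical factor graph Rademacher complexity of `H` on the sample `S`. The expectation over
the independent uniform signs is the average over all sign patterns. The value is extended, because
the supremum may be infinite; it is nonnegative for nonempty `H`. -/
def empComplexity {X : Type u} {Y : Type v} {G : X × Y → OutputGraph Y}
    (H : Set (ScoringFunction G)) {m : ℕ} (S : Fin m → X × Y) : EReal :=
  (((m : ℝ)⁻¹ : ℝ) : EReal) *
    ∑ ε : SignIndex G S → ℤˣ, (((2 ^ Fintype.card (SignIndex G S) : ℝ)⁻¹ : ℝ) : EReal) *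
      ⨆ h ∈ H, ((signedSum S ε h : ℝ) : EReal)

/-- The law of an i.i.d. sample of size `m` from `D`. -/
abbrev sampleLaw {X : Type u} {Y : Type v} [MeasurableSpace X] [MeasurableSpace Y]
    (D : Measure (X × Y)) (m : ℕ) : Measure (Fin m → X × Y) :=
  Measure.pi fun _ => D

/-- The factor graph Rademacher complexity of `H`: the expectation of the empirical one. -/
def complexity {X : Type u} {Y : Type v} [MeasurableSpace X] [MeasurableSpace Y]
    {G : X × Y → OutputGraph Y} (D : Measure (X × Y)) (m : ℕ) (H : Set (ScoringFunction G)) :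
    ℝ≥0∞ :=
  ∫⁻ S, (empComplexity H S).toENNReal ∂(sampleLaw D m)

/-- A family of measurable scoring functions is pointwise measurable if it has a countable
subfamily such that each member of the family is the pointwise limit of a sequence from it. -/
def PointwiseMeasurable {X : Type u} {Y : Type v} [MeasurableSpace X]
    {G : X × Y → OutputGraph Y} (H : Set (ScoringFunction G)) : Prop :=
  (∀ h ∈ H, ∀ y, Measurable fun x => h.score x y) ∧
  ∃ C ⊆ H, C.Countable ∧ ∀ h ∈ H, ∃ u : ℕ → ScoringFunction G, (∀ n, u n ∈ C) ∧
    ∀ x y, Tendsto (fun n => (u n).score x y) atTop (𝓝 (h.score x y))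

/-- A loss function: nonnegative and definite. -/
structure IsLoss {Y : Type v} (L : Y → Y → ℝ) : Prop where
  nonneg : ∀ y y', 0 ≤ L y y'
  definite : ∀ y y', L y y' = 0 ↔ y = y'

/-- `M = max_{y, y'} L(y, y')`, for finite `Y`. -/
def maxLoss {Y : Type v} (L : Y → Y → ℝ) : ℝ :=
  ⨆ q : Y × Y, L q.1 q.2

/-- `Φ(r) = min (M, max (0, r))`. -/
def clip (M r : ℝ) : ℝ :=
  min M (max 0 r)

/-- `g` is a predictor for the score `f`: it is measurable and `g x` maximizes `f x`. Ties may be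
broken in any measurable way. -/
def IsPredictor {X : Type u} {Y : Type v} [MeasurableSpace X] [MeasurableSpace Y]
    (f : X → Y → ℝ) (g : X → Y) : Prop :=
  Measurable g ∧ ∀ x y, f x y ≤ f x (g x)

/-- The generalization error `E_{(x, y) ∼ D} [L(g(x), y)]` of a predictor `g`. -/
def risk {X : Type u} {Y : Type v} [MeasurableSpace X] [MeasurableSpace Y]
    (D : Measure (X × Y)) (L : Y → Y → ℝ) (g : X → Y) : ℝ :=
  ∫ z, L (g z.1) z.2 ∂D

/-- The empirical additive margin loss with parameters `ρ` and `τ`. -/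
def empAddLoss {X : Type u} {Y : Type v} (L : Y → Y → ℝ) (ρ τ : ℝ) {m : ℕ}
    (S : Fin m → X × Y) (f : X → Y → ℝ) : ℝ :=
  (m : ℝ)⁻¹ * ∑ i, clip (maxLoss L) (⨆ y' : {y' // y' ≠ (S i).2},
    (L y' (S i).2 + τ - 1 / ρ * (f (S i).1 (S i).2 - f (S i).1 y')))

/-- The empirical multiplicative margin loss with parameters `ρ` and `τ`. -/
def empMultLoss {X : Type u} {Y : Type v} (L : Y → Y → ℝ) (ρ τ : ℝ) {m : ℕ}
    (S : Fin m → X × Y) (f : X → Y → ℝ) : ℝ :=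
  (m : ℝ)⁻¹ * ∑ i, clip (maxLoss L) (⨆ y' : {y' // y' ≠ (S i).2},
    L y' (S i).2 * (1 + τ - 1 / ρ * (f (S i).1 (S i).2 - f (S i).1 y')))

/-- The score `f = ∑_t α_t h_t` of an ensemble. -/
def ensemble {X : Type u} {Y : Type v} {G : X × Y → OutputGraph Y} {T : ℕ}
    (α : Fin T → ℝ) (h : Fin T → ScoringFunction G) : X → Y → ℝ :=
  fun x y => ∑ t, α t * (h t).score x y

/-- The term `C(ρ, M, c, m, p)`, which also depends on the confidence parameter `δ`. -/
def slack (ρ M δ : ℝ) (c m p : ℕ) : ℝ :=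
  2 * M / ρ * √(Real.log p / m) +
    3 * M * √((⌈4 / ρ ^ 2 * Real.log ((c : ℝ) ^ 2 * ρ ^ 2 * m / (4 * Real.log p))⌉ : ℝ) *
      (Real.log p / m) + Real.log (2 / δ) / (2 * m))

end VRM

end

open scoped BigOperators

namespace VRM

/-! ### Averages over finite products and over signs -/

/-! The convex hull has no complexity bound that separates its components finely enough, so an
ensemble is replaced by a random average of `n` of its members, drawn independently with the weights
`α`. Score differences of members lie in `[-1, 1]`, so by Hoeffding the margin of the average
against a fixed label exceeds or falls short of the ensemble margin by more than `ρ / 2` with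
probability at most `exp (-n ρ² / 8)` on each side. Moving from the risk to the `τ = 1/2` margin
loss of the average costs one such event, for the predicted label. Moving from there, on the sample,
to the `τ = 1` loss of the ensemble costs one event for each wrong label. The total error is `M c
exp (-n ρ² / 8)` (`risk_sub_le`).

It remains to control the `τ = 1/2` deviation of all averages of `n` members. For fixed families
this is McDiarmid's inequality plus symmetrization. A union bound over the `p ^ n` choices of
families adds `n log p` to the logarithm of the inverse confidence
(`measure_exists_deviation_union_le`). The bound for each choice is linear in the complexities of
the chosen families, so averaging over the draw gives exactly `∑ α_t` times the complexity of the
`t`-th family (`sum_weights_averageComplexity`).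

The Rademacher average of the margin losses passes to the factor components by vector contraction. A
margin loss is Lipschitz in the scaled vector `√|F| h_f(x, y)` with constant `2B`, where `B` bounds
the margin weights; the factor `√|F|` comes from Cauchy–Schwarz over the factors. Contraction costs
`√2`, the sharp constant in the `L¹`–`L²` Khinchine inequality, which follows from a spectral
inequality on the discrete cube. Symmetrization costs 2, whence `4 √2 B`.

Finally `n` is the ceiling in the slack, which makes the approximation error at most the first term
of the slack (`exists_le_slack`). Complexities may be infinite, so the bounds are stated in `ℝ≥0∞`;
truncating a negative left side at zero loses nothing because the right sides are nonnegative. -/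

lemma expect_prod_type {α β : Type*} [Fintype α] [Fintype β] (f : α × β → ℝ) :
    𝔼 x, f x = 𝔼 a, 𝔼 b, f (a, b) := by
  rw [← Finset.univ_product_univ, Finset.expect_product]

lemma expect_fin_cons {n : ℕ} {α : Fin (n + 1) → Type*} [∀ i, Fintype (α i)]
    (f : (∀ i, α i) → ℝ) :
    𝔼 x, f x = 𝔼 a : α 0, 𝔼 y : (∀ i : Fin n, α i.succ), f (Fin.cons a y) := by
  rw [← expect_prod_type (fun z : α 0 × (∀ i : Fin n, α i.succ) => f (Fin.cons z.1 z.2))]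
  exact (Fintype.expect_equiv (Fin.consEquiv α) _ _ fun _ => rfl).symm

lemma expect_sign (f : ℤˣ → ℝ) : 𝔼 u, f u = (f 1 + f (-1)) / 2 := by
  rw [Fintype.expect_eq_sum_div_card]
  simp

lemma expect_fin_cons_sign {n : ℕ} (f : (Fin (n + 1) → ℤˣ) → ℝ) :
    𝔼 ε, f ε = 𝔼 ε : Fin n → ℤˣ, (f (Fin.cons 1 ε) + f (Fin.cons (-1) ε)) / 2 := by
  rw [expect_fin_cons, Finset.expect_comm]
  exact Finset.expect_congr rfl fun x _ => expect_sign fun u => f (Fin.cons u x)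

/-! ### A spectral inequality on the discrete cube and Szarek's inequality -/

/-- The sign vector with the `i`-th sign reversed. -/
def flipSign {n : ℕ} (i : Fin n) (ε : Fin n → ℤˣ) : Fin n → ℤˣ := Function.update ε i (-ε i)

/-- The Dirichlet form of a function on the discrete cube. -/
noncomputable def energy {n : ℕ} (f : (Fin n → ℤˣ) → ℝ) : ℝ :=
  𝔼 ε, ∑ i, f ε * (f ε - f (flipSign i ε)) / 2

lemma flipSign_zero_cons {n : ℕ} (u : ℤˣ) (ε : Fin n → ℤˣ) :
    flipSign 0 (Fin.cons u ε : Fin (n + 1) → ℤˣ) = Fin.cons (-u) ε := by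
  simp [flipSign]

lemma flipSign_succ_cons {n : ℕ} (i : Fin n) (u : ℤˣ) (ε : Fin n → ℤˣ) :
    flipSign i.succ (Fin.cons u ε : Fin (n + 1) → ℤˣ) = Fin.cons u (flipSign i ε) := by
  simp [flipSign]

/-- The part of `f` that is even in the first sign. -/
noncomputable def evenPart {n : ℕ} (f : (Fin (n + 1) → ℤˣ) → ℝ) (ε : Fin n → ℤˣ) : ℝ :=
  (f (Fin.cons 1 ε) + f (Fin.cons (-1) ε)) / 2

/-- The part of `f` that is odd in the first sign. -/
noncomputable def oddPart {n : ℕ} (f : (Fin (n + 1) → ℤˣ) → ℝ) (ε : Fin n → ℤˣ) : ℝ :=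
  (f (Fin.cons 1 ε) - f (Fin.cons (-1) ε)) / 2

lemma expect_eq_evenPart {n : ℕ} (f : (Fin (n + 1) → ℤˣ) → ℝ) :
    𝔼 ε, f ε = 𝔼 ε, evenPart f ε :=
  expect_fin_cons_sign f

lemma expect_sq_eq {n : ℕ} (f : (Fin (n + 1) → ℤˣ) → ℝ) :
    𝔼 ε, f ε ^ 2 = 𝔼 ε, evenPart f ε ^ 2 + 𝔼 ε, oddPart f ε ^ 2 := by
  rw [expect_fin_cons_sign, ← Finset.expect_add_distrib]
  refine Finset.expect_congr rfl fun ε _ => ?_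
  simp only [evenPart, oddPart]
  ring

/-- In Fourier terms the energy weights each squared coefficient by its degree. Coefficients
involving the first sign have degree one more than in the odd part, which accounts for the extra
mean square. This identity drives both inductions on the dimension below. -/
lemma energy_eq {n : ℕ} (f : (Fin (n + 1) → ℤˣ) → ℝ) :
    energy f = energy (evenPart f) + energy (oddPart f) + 𝔼 ε, oddPart f ε ^ 2 := by
  simp only [energy]
  rw [expect_fin_cons_sign, ← Finset.expect_add_distrib, ← Finset.expect_add_distrib]
  refine Finset.expect_congr rfl fun ε _ => ?_
  simp only [Fin.sum_univ_succ, flipSign_zero_cons, flipSign_succ_cons, neg_neg]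
  rw [← Finset.sum_add_distrib]
  have : ∀ i : Fin n, evenPart f ε * (evenPart f ε - evenPart f (flipSign i ε)) / 2 +
      oddPart f ε * (oddPart f ε - oddPart f (flipSign i ε)) / 2 =
      (f (Fin.cons 1 ε) * (f (Fin.cons 1 ε) - f (Fin.cons 1 (flipSign i ε))) / 2 +
      f (Fin.cons (-1) ε) * (f (Fin.cons (-1) ε) - f (Fin.cons (-1) (flipSign i ε))) / 2) / 2 := by
    intro i
    simp only [evenPart, oddPart]
    ring
  simp only [this, ← Finset.sum_div, Finset.sum_add_distrib]
  simp only [oddPart]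
  ring

/-- The Poincaré inequality on the discrete cube. -/
lemma expect_sq_le_energy {n : ℕ} (f : (Fin n → ℤˣ) → ℝ) :
    𝔼 ε, f ε ^ 2 ≤ energy f + (𝔼 ε, f ε) ^ 2 := by
  induction n with
  | zero => simp [energy, Finset.univ_unique]
  | succ n ih =>
    rw [expect_sq_eq, energy_eq, expect_eq_evenPart]
    have h1 := ih (evenPart f)
    have h2 : 0 ≤ energy (oddPart f) := by
      have h3 : energy (oddPart f) = 𝔼 ε, ∑ i, (oddPart f ε - oddPart f (flipSign i ε)) ^ 2 / 4 := by
        simp only [energy]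
        rw [Finset.expect_sum_comm, Finset.expect_sum_comm]
        refine Finset.sum_congr rfl fun i _ => ?_
        -- Reversing a sign is an involution of the cube, so each term of the energy can be
        -- symmetrized into a square.
        have h4 : 𝔼 ε, oddPart f ε * (oddPart f ε - oddPart f (flipSign i ε)) / 2 =
            𝔼 ε, oddPart f (flipSign i ε) * (oddPart f (flipSign i ε) - oddPart f ε) / 2 := by
          have inv : Function.Involutive (flipSign i : (Fin n → ℤˣ) → _) := fun ε => by
            simp [flipSign]
          refine (Fintype.expect_equiv inv.toPerm _ _ fun ε => ?_).symm
          simp [inv ε]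
        have h5 : 𝔼 ε, (oddPart f ε - oddPart f (flipSign i ε)) ^ 2 / 4 =
          (𝔼 ε, oddPart f ε * (oddPart f ε - oddPart f (flipSign i ε)) / 2 +
            𝔼 ε, oddPart f (flipSign i ε) * (oddPart f (flipSign i ε) - oddPart f ε) / 2) / 2 := by
          rw [← Finset.expect_add_distrib, Finset.expect_div]
          refine Finset.expect_congr rfl fun ε _ => ?_
          ring
        rw [h5, ← h4]
        ring
      rw [h3]
      exact Finset.expect_nonneg fun ε _ => Finset.sum_nonneg fun i _ => by positivity
    linarith

/-- The spectral gap inequality for functions on the discrete cube up to their Fourier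
coefficients of degree at most one. -/
lemma two_mul_expect_sq_le {n : ℕ} (f : (Fin n → ℤˣ) → ℝ) :
    2 * 𝔼 ε, f ε ^ 2 ≤
      energy f + 2 * (𝔼 ε, f ε) ^ 2 + ∑ i, (𝔼 ε, ((ε i : ℤ) : ℝ) * f ε) ^ 2 := by
  induction n with
  | zero => simp [energy, Finset.univ_unique]
  | succ n ih =>
    have h1 := ih (evenPart f)
    -- The odd part already gains one mean square from `energy_eq`, so the Poincaré inequality
    -- supplies the second; its mean is the first-order coefficient of the new sign (`h3`).
    have h2 := expect_sq_le_energy (oddPart f)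
    have h3 : 𝔼 ε : Fin (n + 1) → ℤˣ, ((ε 0 : ℤ) : ℝ) * f ε = 𝔼 ε, oddPart f ε := by
      rw [expect_fin_cons_sign]
      refine Finset.expect_congr rfl fun ε _ => ?_
      simp [oddPart]
      ring
    have h4 : ∀ i : Fin n, 𝔼 ε : Fin (n + 1) → ℤˣ, ((ε i.succ : ℤ) : ℝ) * f ε =
        𝔼 ε, ((ε i : ℤ) : ℝ) * evenPart f ε := by
      intro i
      rw [expect_fin_cons_sign]
      refine Finset.expect_congr rfl fun ε _ => ?_
      simp [evenPart]
      ring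
    rw [expect_sq_eq, energy_eq, expect_eq_evenPart, Fin.sum_univ_succ, h3]
    simp only [h4]
    linarith

lemma expect_sign_sum_sq {n : ℕ} (v : Fin n → ℝ) :
    𝔼 ε : Fin n → ℤˣ, (∑ i, ((ε i : ℤ) : ℝ) * v i) ^ 2 = ∑ i, v i ^ 2 := by
  induction n with
  | zero => simp [Finset.univ_unique]
  | succ n ih =>
    rw [expect_fin_cons_sign, Fin.sum_univ_succ, ← ih (fun i => v i.succ),
      ← Finset.expect_const (s := (Finset.univ : Finset (Fin n → ℤˣ))) Finset.univ_nonempty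
        (v 0 ^ 2), ← Finset.expect_add_distrib]
    refine Finset.expect_congr rfl fun ε _ => ?_
    simp [Fin.sum_univ_succ]
    ring

lemma sum_sign_flipSign {n : ℕ} (v : Fin n → ℝ) (ε : Fin n → ℤˣ) (i : Fin n) :
    ∑ j, ((flipSign i ε j : ℤ) : ℝ) * v j =
      ∑ j, ((ε j : ℤ) : ℝ) * v j - 2 * (((ε i : ℤ) : ℝ) * v i) := by
  have : ∀ j, ((flipSign i ε j : ℤ) : ℝ) * v j =
      ((ε j : ℤ) : ℝ) * v j - if j = i then 2 * (((ε i : ℤ) : ℝ) * v i) else 0 := by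
    intro j
    by_cases h : j = i
    · subst h; simp [flipSign]; ring
    · simp [flipSign, h]
  simp [this, Finset.sum_sub_distrib]

/-- Khinchine's inequality with the optimal constant (Szarek), on `Fin n`. -/
lemma sqrt_sum_sq_le_fin {n : ℕ} (v : Fin n → ℝ) :
    √(∑ i, v i ^ 2) ≤ √2 * 𝔼 ε : Fin n → ℤˣ, |∑ i, ((ε i : ℤ) : ℝ) * v i| := by
  set f : (Fin n → ℤˣ) → ℝ := fun ε => |∑ i, ((ε i : ℤ) : ℝ) * v i| with hf
  have hsq : 𝔼 ε, f ε ^ 2 = ∑ i, v i ^ 2 := by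
    simp only [hf, sq_abs, expect_sign_sum_sq]
  have hpt : ∀ ε, ∑ i, f ε * (f ε - f (flipSign i ε)) / 2 ≤ f ε ^ 2 := by
    intro ε
    -- Summing the linear form over the `n` single flips multiplies it by `n - 2`; the triangle
    -- inequality then gives the claim. Thus the energy of the absolute value is at most its mean
    -- square.
    have h1 : (n - 2 : ℝ) * f ε ≤ ∑ i, f (flipSign i ε) := by
      calc (n - 2 : ℝ) * f ε ≤ |(n - 2 : ℝ) * ∑ i, ((ε i : ℤ) : ℝ) * v i| := by
            rw [abs_mul]
            exact mul_le_mul_of_nonneg_right (le_abs_self _) (abs_nonneg _)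
        _ = |∑ i, ∑ j, ((flipSign i ε j : ℤ) : ℝ) * v j| := by
            simp only [sum_sign_flipSign, Finset.sum_sub_distrib, ← Finset.mul_sum]
            simp only [Finset.sum_const, Finset.card_univ, Fintype.card_fin, nsmul_eq_mul]
            ring_nf
        _ ≤ ∑ i, f (flipSign i ε) := Finset.abs_sum_le_sum_abs _ _
    have h0 : 0 ≤ f ε := abs_nonneg _
    rw [← Finset.sum_div, ← Finset.mul_sum, Finset.sum_sub_distrib]
    simp only [Finset.sum_const, Finset.card_univ, Fintype.card_fin, nsmul_eq_mul]
    nlinarith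
  have hen : energy f ≤ 𝔼 ε, f ε ^ 2 := Finset.expect_le_expect fun ε _ => hpt ε
  -- The absolute value is even, so its first-order coefficients vanish and the spectral inequality
  -- has only the mean left on the right.
  have hodd : ∀ i, 𝔼 ε : Fin n → ℤˣ, ((ε i : ℤ) : ℝ) * f ε = 0 := by
    intro i
    have : 𝔼 ε : Fin n → ℤˣ, ((ε i : ℤ) : ℝ) * f ε =
        𝔼 ε : Fin n → ℤˣ, -(((ε i : ℤ) : ℝ) * f ε) := by
      refine Fintype.expect_equiv (Equiv.neg (Fin n → ℤˣ)) _ _ fun ε => ?_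
      simp [hf]
    rw [Finset.expect_neg_distrib] at this
    linarith
  have key := two_mul_expect_sq_le f
  simp only [hodd] at key
  have h2 : ∑ i, v i ^ 2 ≤ 2 * (𝔼 ε, f ε) ^ 2 := by
    rw [← hsq]
    simp at key
    linarith
  have hnn : 0 ≤ 𝔼 ε, f ε := Finset.expect_nonneg fun ε _ => abs_nonneg _
  calc √(∑ i, v i ^ 2) ≤ √(2 * (𝔼 ε, f ε) ^ 2) := Real.sqrt_le_sqrt h2
    _ = √2 * 𝔼 ε, f ε := by rw [Real.sqrt_mul (by norm_num), Real.sqrt_sq hnn]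

/-- Khinchine's inequality with the optimal constant (Szarek). -/
lemma sqrt_sum_sq_le {J : Type*} [Fintype J] [DecidableEq J] (v : J → ℝ) :
    √(∑ j, v j ^ 2) ≤ √2 * 𝔼 ε : J → ℤˣ, |∑ j, ((ε j : ℤ) : ℝ) * v j| := by
  let e := Fintype.equivFin J
  have h := sqrt_sum_sq_le_fin fun i => v (e.symm i)
  rw [e.symm.sum_comp (fun j => v j ^ 2)] at h
  refine h.trans_eq ?_
  congr 1
  refine Fintype.expect_equiv (Equiv.arrowCongr e.symm (Equiv.refl ℤˣ)) _ _ fun ε => ?_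
  congr 1
  refine Fintype.sum_equiv e.symm _ _ fun i => ?_
  simp [Equiv.arrowCongr]

/-! ### The vector contraction inequality -/

lemma le_iSup_of_finite {I : Type*} [Finite I] (f : I → ℝ) (i : I) : f i ≤ ⨆ i, f i :=
  le_ciSup (Set.finite_range f).bddAbove i

section Contraction

variable {I : Type*} [Finite I] [Nonempty I]

/-- The vector contraction inequality for a single vector of signs. -/
lemma contraction_step {J : Type*} [Fintype J] [DecidableEq J] (U ψ : I → ℝ) (φ : I → J → ℝ) {K : ℝ}
    (hK : 0 ≤ K) (hψ : ∀ g g', |ψ g - ψ g'| ≤ K * √(∑ j, (φ g j - φ g' j) ^ 2)) :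
    𝔼 u : ℤˣ, ⨆ g, (U g + ((u : ℤ) : ℝ) * ψ g) ≤
      𝔼 ε : J → ℤˣ, ⨆ g, (U g + √2 * K * ∑ j, ((ε j : ℤ) : ℝ) * φ g j) := by
  set R := 𝔼 ε : J → ℤˣ, ⨆ g, (U g + √2 * K * ∑ j, ((ε j : ℤ) : ℝ) * φ g j) with hR
  have hneg : 𝔼 ε : J → ℤˣ, ⨆ g, (U g - √2 * K * ∑ j, ((ε j : ℤ) : ℝ) * φ g j) = R := by
    refine Fintype.expect_equiv (Equiv.neg (J → ℤˣ)) _ _ fun ε => ?_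
    simp [sub_eq_add_neg]
  -- Averaging over the single sign gives half the sum of two suprema, so it suffices to bound every
  -- pair. The Lipschitz bound and Khinchine turn `ψ g - ψ g'` into a mean absolute value.
  have key : ∀ g g', U g + ψ g + (U g' - ψ g') ≤ 2 * R := by
    intro g g'
    have h1 : ψ g - ψ g' ≤
        𝔼 ε : J → ℤˣ, √2 * K * |∑ j, ((ε j : ℤ) : ℝ) * (φ g j - φ g' j)| := by
      rw [← Finset.mul_expect]
      calc ψ g - ψ g' ≤ K * √(∑ j, (φ g j - φ g' j) ^ 2) := (le_abs_self _).trans (hψ g g')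
        _ ≤ K * (√2 * 𝔼 ε : J → ℤˣ, |∑ j, ((ε j : ℤ) : ℝ) * (φ g j - φ g' j)|) :=
          mul_le_mul_of_nonneg_left (sqrt_sum_sq_le _) hK
        _ = _ := by ring
    have h2 : 2 * R = 𝔼 ε : J → ℤˣ, ((⨆ g, (U g + √2 * K * ∑ j, ((ε j : ℤ) : ℝ) * φ g j)) +
        ⨆ g, (U g - √2 * K * ∑ j, ((ε j : ℤ) : ℝ) * φ g j)) := by
      rw [Finset.expect_add_distrib, hneg]
      ring
    have h3 : U g + U g' = 𝔼 _ε : J → ℤˣ, (U g + U g') := (Fintype.expect_const _).symm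
    have h4 : U g + ψ g + (U g' - ψ g') ≤ 𝔼 ε : J → ℤˣ, (U g + U g' +
        √2 * K * |∑ j, ((ε j : ℤ) : ℝ) * (φ g j - φ g' j)|) := by
      rw [Finset.expect_add_distrib, ← h3]
      linarith
    rw [h2]
    refine h4.trans (Finset.expect_le_expect fun ε _ => ?_)
    have hs : ∑ j, ((ε j : ℤ) : ℝ) * (φ g j - φ g' j) =
        ∑ j, ((ε j : ℤ) : ℝ) * φ g j - ∑ j, ((ε j : ℤ) : ℝ) * φ g' j := by
      simp [mul_sub, Finset.sum_sub_distrib]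
    rw [hs]
    have a1 := le_iSup_of_finite (fun g => U g + √2 * K * ∑ j, ((ε j : ℤ) : ℝ) * φ g j) g
    have a2 := le_iSup_of_finite (fun g => U g + √2 * K * ∑ j, ((ε j : ℤ) : ℝ) * φ g j) g'
    have b1 := le_iSup_of_finite (fun g => U g - √2 * K * ∑ j, ((ε j : ℤ) : ℝ) * φ g j) g
    have b2 := le_iSup_of_finite (fun g => U g - √2 * K * ∑ j, ((ε j : ℤ) : ℝ) * φ g j) g'
    -- The sign of the difference decides which of `g`, `g'` is tested in the supremum with `+` and
    -- which in the one with `-`.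
    rcases abs_cases (∑ j, ((ε j : ℤ) : ℝ) * φ g j - ∑ j, ((ε j : ℤ) : ℝ) * φ g' j) with h | h <;>
    · rw [h.1]
      linarith
  rw [expect_sign]
  have h5 : (⨆ g, (U g + ψ g)) ≤ 2 * R - ⨆ g, (U g - ψ g) := by
    refine ciSup_le fun g => ?_
    rw [le_sub_comm]
    refine ciSup_le fun g' => ?_
    linarith [key g g']
  simp only [Units.val_one, Int.cast_one, one_mul, Units.val_neg, Int.cast_neg, neg_mul,
    ← sub_eq_add_neg]
  linarith

/-- The vector contraction inequality for Rademacher averages (Maurer). -/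
lemma vector_contraction {m : ℕ} {J : Fin m → Type*} [∀ i, Fintype (J i)] [∀ i, DecidableEq (J i)]
    (U : I → ℝ) (ψ : Fin m → I → ℝ) (φ : ∀ i, I → J i → ℝ) {K : ℝ} (hK : 0 ≤ K)
    (hψ : ∀ i g g', |ψ i g - ψ i g'| ≤ K * √(∑ j, (φ i g j - φ i g' j) ^ 2)) :
    𝔼 ε : Fin m → ℤˣ, ⨆ g, (U g + ∑ i, ((ε i : ℤ) : ℝ) * ψ i g) ≤
      𝔼 e : (∀ i, J i → ℤˣ), ⨆ g, (U g + √2 * K * ∑ i, ∑ j, ((e i j : ℤ) : ℝ) * φ i g j) := by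
  -- The arbitrary offset `U` absorbs all other coordinates while the signs of one coordinate are
  -- replaced.
  induction m generalizing U with
  | zero => simp [Finset.univ_unique]
  | succ m ih =>
    rw [expect_fin_cons, expect_fin_cons]
    calc 𝔼 u : ℤˣ, 𝔼 ε : Fin m → ℤˣ, ⨆ g, (U g +
          ∑ i, (((Fin.cons u ε : Fin (m + 1) → ℤˣ) i : ℤ) : ℝ) * ψ i g)
        = 𝔼 u : ℤˣ, 𝔼 ε : Fin m → ℤˣ, ⨆ g, ((U g + ((u : ℤ) : ℝ) * ψ 0 g) +
          ∑ i, ((ε i : ℤ) : ℝ) * ψ i.succ g) := by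
          refine Finset.expect_congr rfl fun u _ => Finset.expect_congr rfl fun ε _ => ?_
          simp [Fin.sum_univ_succ, add_assoc]
      _ ≤ 𝔼 u : ℤˣ, 𝔼 e : (∀ i : Fin m, J i.succ → ℤˣ), ⨆ g, ((U g + ((u : ℤ) : ℝ) * ψ 0 g) +
          √2 * K * ∑ i : Fin m, ∑ j, ((e i j : ℤ) : ℝ) * φ i.succ g j) :=
          Finset.expect_le_expect fun u _ => ih _ (fun i => ψ i.succ) (fun i => φ i.succ)
            fun i => hψ i.succ
      _ = 𝔼 e : (∀ i : Fin m, J i.succ → ℤˣ), 𝔼 u : ℤˣ, ⨆ g,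
          ((U g + √2 * K * ∑ i : Fin m, ∑ j, ((e i j : ℤ) : ℝ) * φ i.succ g j) +
            ((u : ℤ) : ℝ) * ψ 0 g) := by
          rw [Finset.expect_comm]
          simp only [add_right_comm]
      _ ≤ 𝔼 e : (∀ i : Fin m, J i.succ → ℤˣ), 𝔼 e0 : J 0 → ℤˣ, ⨆ g,
          ((U g + √2 * K * ∑ i : Fin m, ∑ j, ((e i j : ℤ) : ℝ) * φ i.succ g j) +
            √2 * K * ∑ j, ((e0 j : ℤ) : ℝ) * φ 0 g j) :=
          Finset.expect_le_expect fun e _ => contraction_step _ _ _ hK (hψ 0)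
      _ = _ := by
          rw [Finset.expect_comm]
          refine Finset.expect_congr rfl fun e0 _ => Finset.expect_congr rfl fun e _ => ?_
          simp only [Fin.sum_univ_succ, Fin.cons_zero, Fin.cons_succ, mul_add]
          refine iSup_congr fun g => ?_
          ring

end Contraction

/-! ### McDiarmid's inequality -/

lemma abs_iSup_le_of_finite {I : Type*} [Finite I] [Nonempty I] {f : I → ℝ} {C : ℝ}
    (h : ∀ i, |f i| ≤ C) : |⨆ i, f i| ≤ C := by
  refine abs_le.2 ⟨?_, ciSup_le fun i => (abs_le.1 (h i)).2⟩
  obtain ⟨i⟩ := ‹Nonempty I›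
  exact (abs_le.1 (h i)).1.trans (le_iSup_of_finite f i)

lemma integrable_of_abs_le {Ω : Type*} [MeasurableSpace Ω] {μ : Measure Ω} [IsFiniteMeasure μ]
    {f : Ω → ℝ} (hf : Measurable f) {C : ℝ} (hC : ∀ x, |f x| ≤ C) : Integrable f μ :=
  Integrable.of_bound hf.aestronglyMeasurable C (ae_of_all _ hC)

/-- Hoeffding's lemma for a function whose oscillation is at most `c`. -/
lemma integral_exp_le_of_oscillation {Z : Type*} [MeasurableSpace Z] (D : Measure Z)
    [IsProbabilityMeasure D] {X : Z → ℝ} (hX : Measurable X) {c : ℝ}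
    (hc : ∀ z z', X z - X z' ≤ c) (t : ℝ) :
    ∫ z, Real.exp (t * X z) ∂D ≤ Real.exp (t * ∫ z, X z ∂D + t ^ 2 * c ^ 2 / 8) := by
  obtain ⟨z₀⟩ := nonempty_of_isProbabilityMeasure D
  have hbdd : BddBelow (Set.range X) := ⟨X z₀ - c, by rintro _ ⟨z, rfl⟩; linarith [hc z₀ z]⟩
  have : Nonempty Z := ⟨z₀⟩
  -- An oscillation of at most `c` places all values in an interval of length `c` starting at the
  -- infimum.
  set a := ⨅ z, X z
  have hmem : ∀ z, X z ∈ Set.Icc a (a + c) := fun z =>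
    ⟨ciInf_le hbdd z, by
      have : X z - c ≤ a := le_ciInf fun z' => by linarith [hc z z']
      linarith⟩
  have h := (ProbabilityTheory.hasSubgaussianMGF_of_mem_Icc (μ := D) hX.aemeasurable
    (ae_of_all _ hmem)).mgf_le t
  simp only [ProbabilityTheory.mgf, add_sub_cancel_left] at h
  have e1 : ∀ z, Real.exp (t * X z) =
      Real.exp (t * ∫ z, X z ∂D) * Real.exp (t * (X z - ∫ z, X z ∂D)) := fun z => by
    rw [← Real.exp_add]; ring_nf
  simp only [e1]
  rw [integral_const_mul, Real.exp_add]
  refine mul_le_mul_of_nonneg_left (h.trans (Real.exp_le_exp.2 (le_of_eq ?_))) (Real.exp_pos _).le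
  simp only [NNReal.coe_pow, NNReal.coe_div, coe_nnnorm, Real.norm_eq_abs, NNReal.coe_ofNat,
    div_pow, sq_abs]
  ring

lemma integral_pi_fin_succ {Z : Type*} [MeasurableSpace Z] (D : Measure Z)
    [IsProbabilityMeasure D] {m : ℕ} {f : (Fin (m + 1) → Z) → ℝ} (hf : Measurable f) {C : ℝ}
    (hC : ∀ S, |f S| ≤ C) :
    ∫ S, f S ∂(Measure.pi fun _ : Fin (m + 1) => D) =
      ∫ S, ∫ z, f (Fin.cons z S) ∂D ∂(Measure.pi fun _ : Fin m => D) := by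
  rw [← ((measurePreserving_piFinSuccAbove (fun _ : Fin (m + 1) => D) 0).symm).integral_comp',
    integral_prod_symm]
  · simp [MeasurableEquiv.piFinSuccAbove_symm_apply, Fin.insertNthEquiv]
  · exact integrable_of_abs_le (hf.comp (MeasurableEquiv.measurable _)) fun x => hC _

lemma measurable_fin_cons {Z : Type*} [MeasurableSpace Z] {m : ℕ} :
    Measurable fun q : Z × (Fin m → Z) => (Fin.cons q.1 q.2 : Fin (m + 1) → Z) := by
  refine measurable_pi_iff.2 fun i => ?_
  refine Fin.cases ?_ (fun i => ?_) i
  · simpa using measurable_fst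
  · simpa [Function.comp_def] using
      (measurable_pi_apply (X := fun _ : Fin m => Z) i).comp (measurable_snd (α := Z))

/-- The exponential moment bound behind McDiarmid's inequality. -/
lemma integral_exp_le_of_bounded_differences {Z : Type*} [MeasurableSpace Z] (D : Measure Z)
    [IsProbabilityMeasure D] {m : ℕ} {f : (Fin m → Z) → ℝ} (hf : Measurable f) {C c : ℝ}
    (hC : ∀ S, |f S| ≤ C) (hc : ∀ S i z, f (Function.update S i z) - f S ≤ c) (t : ℝ) :
    ∫ S, Real.exp (t * f S) ∂(Measure.pi fun _ : Fin m => D) ≤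
      Real.exp (t * ∫ S, f S ∂(Measure.pi fun _ : Fin m => D) + m * (t ^ 2 * c ^ 2 / 8)) := by
  induction m with
  | zero => simp [integral_unique]
  | succ m ih =>
    have hexpC : ∀ x : ℝ, |x| ≤ C → |Real.exp (t * x)| ≤ Real.exp (|t| * C) := fun x hx => by
      rw [abs_of_pos (Real.exp_pos _)]
      refine Real.exp_le_exp.2 ((le_abs_self _).trans ?_)
      rw [abs_mul]
      exact mul_le_mul_of_nonneg_left hx (abs_nonneg _)
    have hslice : ∀ S : Fin m → Z, Measurable fun z => f (Fin.cons z S) := fun S =>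
      hf.comp (measurable_fin_cons.comp measurable_prodMk_right)
    have hint : ∀ S : Fin m → Z, Integrable (fun z => f (Fin.cons z S)) D := fun S =>
      integrable_of_abs_le (hslice S) fun z => hC _
    -- Integrating out the first coordinate preserves the bound and the bounded differences, so the
    -- induction hypothesis applies to `g`. The fluctuation in that coordinate costs `t² c² / 8` by
    -- Hoeffding's lemma.
    set g : (Fin m → Z) → ℝ := fun S => ∫ z, f (Fin.cons z S) ∂D with hg
    have hgm : Measurable g :=
      (StronglyMeasurable.integral_prod_left (μ := D)
        (f := fun z (S : Fin m → Z) => f (Fin.cons z S))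
        (hf.comp measurable_fin_cons).stronglyMeasurable).measurable
    have hgC : ∀ S, |g S| ≤ C := fun S => by
      have := norm_integral_le_of_norm_le_const (μ := D) (f := fun z => f (Fin.cons z S)) (C := C)
        (ae_of_all _ fun z => hC _)
      simpa using this
    have hgc : ∀ S i z, g (Function.update S i z) - g S ≤ c := fun S i z => by
      rw [hg]
      simp only
      rw [← integral_sub (hint _) (hint _)]
      calc _ ≤ ∫ _z, c ∂D := by
            refine integral_mono ((hint _).sub (hint _)) (integrable_const _) fun w => ?_
            simp only [Fin.cons_update]
            exact hc _ _ _
        _ = c := by simp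
    rw [integral_pi_fin_succ D (C := Real.exp (|t| * C)) (by fun_prop) fun S => hexpC _ (hC S),
      integral_pi_fin_succ D hf hC]
    calc ∫ S, ∫ z, Real.exp (t * f (Fin.cons z S)) ∂D ∂(Measure.pi fun _ : Fin m => D)
        ≤ ∫ S, Real.exp (t * g S) * Real.exp (t ^ 2 * c ^ 2 / 8)
            ∂(Measure.pi fun _ : Fin m => D) := by
          refine integral_mono_of_nonneg (ae_of_all _ fun S => integral_nonneg fun z =>
            (Real.exp_pos _).le) ?_ (ae_of_all _ fun S => ?_)
          · refine Integrable.mul_const ?_ _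
            exact integrable_of_abs_le (by fun_prop) fun S => hexpC _ (hgC S)
          · simp only
            rw [← Real.exp_add]
            refine integral_exp_le_of_oscillation D (hslice S) (fun z z' => ?_) t
            have := hc (Fin.cons z' S) 0 z
            rwa [Fin.update_cons_zero] at this
      _ ≤ Real.exp (t * ∫ S, g S ∂(Measure.pi fun _ : Fin m => D) + m * (t ^ 2 * c ^ 2 / 8)) *
            Real.exp (t ^ 2 * c ^ 2 / 8) := by
          rw [integral_mul_const]
          exact mul_le_mul_of_nonneg_right (ih hgm hgC hgc) (Real.exp_pos _).le
      _ = _ := by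
          rw [← Real.exp_add]
          push_cast
          congr 1
          ring

/-- McDiarmid's bounded differences inequality. -/
theorem measure_ge_le_of_bounded_differences {Z : Type*} [MeasurableSpace Z] (D : Measure Z)
    [IsProbabilityMeasure D] {m : ℕ} {f : (Fin m → Z) → ℝ} (hf : Measurable f) {C c : ℝ}
    (hC : ∀ S, |f S| ≤ C) (hc : ∀ S i z, f (Function.update S i z) - f S ≤ c) {t : ℝ}
    (ht : 0 ≤ t) :
    (Measure.pi fun _ : Fin m => D).real
        {S | t ≤ f S - ∫ S, f S ∂(Measure.pi fun _ : Fin m => D)} ≤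
      Real.exp (-2 * t ^ 2 / (m * c ^ 2)) := by
  set P := Measure.pi fun _ : Fin m => D
  set E := ∫ S, f S ∂P with hE
  have hv : (0 : ℝ) ≤ m * (c ^ 2 / 4) := by positivity
  have hsub : ProbabilityTheory.HasSubgaussianMGF (fun S => f S - E)
      (m * (c ^ 2 / 4)).toNNReal P := by
    refine ⟨fun s => ?_, fun s => ?_⟩
    · refine integrable_of_abs_le (C := Real.exp (|s| * (C + |E|))) (by fun_prop) fun S => ?_
      rw [abs_of_pos (Real.exp_pos _)]
      refine Real.exp_le_exp.2 ((le_abs_self _).trans ?_)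
      rw [abs_mul]
      refine mul_le_mul_of_nonneg_left ((abs_sub _ _).trans ?_) (abs_nonneg _)
      linarith [hC S]
    · have h := integral_exp_le_of_bounded_differences D hf hC hc s
      rw [Real.coe_toNNReal _ hv]
      simp only [ProbabilityTheory.mgf]
      have e1 : ∀ S, Real.exp (s * (f S - E)) = Real.exp (s * f S) * Real.exp (-(s * E)) :=
        fun S => by rw [← Real.exp_add]; ring_nf
      simp only [e1]
      rw [integral_mul_const]
      calc _ ≤ _ := mul_le_mul_of_nonneg_right h (Real.exp_pos _).le
        _ = _ := by rw [← Real.exp_add]; congr 1; simp only [hE, P]; ring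
  refine (hsub.measure_ge_le ht).trans (Real.exp_le_exp.2 (le_of_eq ?_))
  rw [Real.coe_toNNReal _ hv, show (2 : ℝ) * (m * (c ^ 2 / 4)) = (m * c ^ 2) / 2 by ring, div_div_eq_mul_div]
  ring

/-! ### Symmetrization and uniform deviations of finite classes -/

lemma integrable_iSup_of_abs_le {Ω I : Type*} [Finite I] [Nonempty I] [MeasurableSpace Ω]
    {μ : Measure Ω} [IsFiniteMeasure μ] {f : I → Ω → ℝ} (hf : ∀ i, Measurable (f i)) {C : ℝ}
    (hC : ∀ i x, |f i x| ≤ C) : Integrable (fun x => ⨆ i, f i x) μ :=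
  integrable_of_abs_le (Measurable.iSup hf) fun x => abs_iSup_le_of_finite fun i => hC i x

lemma integral_comp_of_measurePreserving {Ω Ω' : Type*} [MeasurableSpace Ω] [MeasurableSpace Ω']
    {μ : Measure Ω} {ν : Measure Ω'} {T : Ω → Ω'} (hT : MeasurePreserving T μ ν) {f : Ω' → ℝ}
    (hf : Measurable f) : ∫ x, f (T x) ∂μ = ∫ y, f y ∂ν := by
  rw [← hT.map_eq, integral_map hT.measurable.aemeasurable hf.aestronglyMeasurable]

lemma abs_integral_le_of_abs_le {Ω : Type*} [MeasurableSpace Ω] {μ : Measure Ω}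
    [IsProbabilityMeasure μ] {f : Ω → ℝ} {C : ℝ} (hC : ∀ x, |f x| ≤ C) : |∫ x, f x ∂μ| ≤ C := by
  have h := norm_integral_le_of_norm_le_const (μ := μ) (f := f) (C := C) (ae_of_all _ hC)
  simpa using h

lemma abs_average_le {m : ℕ} {a : Fin m → ℝ} {C : ℝ} (hC0 : 0 ≤ C) (ha : ∀ j, |a j| ≤ C) :
    |(m : ℝ)⁻¹ * ∑ j, a j| ≤ C := by
  rcases Nat.eq_zero_or_pos m with rfl | hm
  · simpa using hC0
  have hm' : (0 : ℝ) < m := by exact_mod_cast hm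
  rw [abs_mul, abs_of_pos (inv_pos.2 hm'), inv_mul_le_iff₀ hm']
  calc |∑ j, a j| ≤ ∑ j, |a j| := Finset.abs_sum_le_sum_abs _ _
    _ ≤ ∑ _j : Fin m, C := Finset.sum_le_sum fun j _ => ha j
    _ = m * C := by simp

lemma abs_sign_mul (u : ℤˣ) (x : ℝ) : |((u : ℤ) : ℝ) * x| = |x| := by
  rcases Int.units_eq_one_or u with rfl | rfl <;> simp

section Symmetrization

variable {Z I : Type*} [MeasurableSpace Z] [Finite I] [Nonempty I]

/-- The true mean is the mean over an independent ghost sample, and a supremum of integrals is at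
most the integral of the supremum. The two samples are stored as one sample of pairs, so that single
coordinates can be swapped afterwards. -/
lemma integral_iSup_deviation_le_ghost (D : Measure Z) [IsProbabilityMeasure D] {m : ℕ}
    (hm : 1 ≤ m) {ψ : I → Z → ℝ} (hψ : ∀ i, Measurable (ψ i)) {M : ℝ} (hM : ∀ i z, |ψ i z| ≤ M) :
    ∫ S, ⨆ i, (∫ z, ψ i z ∂D - (m : ℝ)⁻¹ * ∑ j, ψ i (S j)) ∂(Measure.pi fun _ : Fin m => D) ≤
      ∫ W, ⨆ i, (m : ℝ)⁻¹ * ∑ j, (ψ i (W j).2 - ψ i (W j).1)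
        ∂(Measure.pi fun _ : Fin m => D.prod D) := by
  obtain ⟨z₀⟩ := nonempty_of_isProbabilityMeasure D
  obtain ⟨i₀⟩ := ‹Nonempty I›
  have : Nonempty I := ⟨i₀⟩
  have hM0 : 0 ≤ M := (abs_nonneg _).trans (hM i₀ z₀)
  set P := Measure.pi fun _ : Fin m => D with hP
  have hdiff : ∀ i z z', |ψ i z' - ψ i z| ≤ 2 * M := fun i z z' => by
    linarith [abs_sub (ψ i z') (ψ i z), hM i z, hM i z']
  have hmeas : ∀ i, Measurable fun q : (Fin m → Z) × (Fin m → Z) =>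
      (m : ℝ)⁻¹ * ∑ j, (ψ i (q.2 j) - ψ i (q.1 j)) := fun i => by
    have := hψ i
    fun_prop
  have hbd : ∀ i (q : (Fin m → Z) × (Fin m → Z)),
      |(m : ℝ)⁻¹ * ∑ j, (ψ i (q.2 j) - ψ i (q.1 j))| ≤ 2 * M := fun i q =>
    abs_average_le (by positivity) fun j => hdiff i _ _
  have hint := integrable_iSup_of_abs_le (μ := P.prod P) hmeas hbd
  have hpt : ∀ S : Fin m → Z, (⨆ i, (∫ z, ψ i z ∂D - (m : ℝ)⁻¹ * ∑ j, ψ i (S j))) ≤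
      ∫ S', ⨆ i, (m : ℝ)⁻¹ * ∑ j, (ψ i (S' j) - ψ i (S j)) ∂P := by
    intro S
    refine ciSup_le fun i => ?_
    have h1 : ∫ S' : Fin m → Z, (m : ℝ)⁻¹ * ∑ j, (ψ i (S' j) - ψ i (S j)) ∂P =
        ∫ z, ψ i z ∂D - (m : ℝ)⁻¹ * ∑ j, ψ i (S j) := by
      rw [integral_const_mul, integral_finsetSum]
      · have h2 : ∀ j : Fin m, ∫ S' : Fin m → Z, (ψ i (S' j) - ψ i (S j)) ∂P =
            ∫ z, ψ i z ∂D - ψ i (S j) := fun j => by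
          have hev := measurePreserving_eval (fun _ : Fin m => D) j
          rw [integral_sub _ (integrable_const _),
            integral_comp_of_measurePreserving hev (hψ i)]
          · simp
          · exact integrable_of_abs_le ((hψ i).comp hev.measurable) fun x => hM i _
        simp only [h2, Finset.sum_sub_distrib]
        simp only [Finset.sum_const, Finset.card_univ, Fintype.card_fin, nsmul_eq_mul]
        have : (m : ℝ) ≠ 0 := by positivity
        field_simp
      · intro j _
        have := hψ i
        exact integrable_of_abs_le (by fun_prop) fun x => hdiff i _ _
    rw [← h1]
    have hs : ∀ i, Measurable fun S' : Fin m → Z => (m : ℝ)⁻¹ * ∑ j, (ψ i (S' j) - ψ i (S j)) :=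
      fun i => (hmeas i).comp measurable_prodMk_left
    refine integral_mono (integrable_of_abs_le (hs i) fun S' => hbd i (S, S'))
      (integrable_iSup_of_abs_le hs fun i S' => hbd i (S, S')) fun S' => ?_
    exact le_iSup_of_finite (fun i => (m : ℝ)⁻¹ * ∑ j, (ψ i (S' j) - ψ i (S j))) i
  have hcm : ∀ i, Measurable fun S : Fin m → Z =>
      (∫ z, ψ i z ∂D) - (m : ℝ)⁻¹ * ∑ j, ψ i (S j) := fun i => by
    have := hψ i
    fun_prop
  have hcb : ∀ i (S : Fin m → Z), |(∫ z, ψ i z ∂D) - (m : ℝ)⁻¹ * ∑ j, ψ i (S j)| ≤ 2 * M :=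
    fun i S => by
      have h1 : |∫ z, ψ i z ∂D| ≤ M := abs_integral_le_of_abs_le (hM i)
      have h2 := abs_average_le hM0 fun j => hM i (S j)
      linarith [abs_sub (∫ z, ψ i z ∂D) ((m : ℝ)⁻¹ * ∑ j, ψ i (S j))]
  have hleft : Integrable (fun S : Fin m → Z =>
      ⨆ i, ((∫ z, ψ i z ∂D) - (m : ℝ)⁻¹ * ∑ j, ψ i (S j))) P :=
    integrable_iSup_of_abs_le hcm hcb
  have hright : Integrable (fun S : Fin m → Z =>
      ∫ S', ⨆ i, (m : ℝ)⁻¹ * ∑ j, (ψ i (S' j) - ψ i (S j)) ∂P) P := hint.integral_prod_left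
  calc _ ≤ ∫ S, ∫ S', ⨆ i, (m : ℝ)⁻¹ * ∑ j, (ψ i (S' j) - ψ i (S j)) ∂P ∂P :=
        integral_mono hleft hright hpt
    _ = ∫ q, ⨆ i, (m : ℝ)⁻¹ * ∑ j, (ψ i (q.2 j) - ψ i (q.1 j)) ∂(P.prod P) :=
        (integral_prod _ hint).symm
    _ = _ := by
        rw [← (measurePreserving_arrowProdEquivProdArrow Z Z (Fin m) (fun _ => D)
          (fun _ => D)).integral_comp']
        rfl

/-- The symmetrization inequality for a finite class of bounded functions. -/
lemma integral_iSup_deviation_le (D : Measure Z) [IsProbabilityMeasure D] {m : ℕ}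
    (hm : 1 ≤ m) {ψ : I → Z → ℝ} (hψ : ∀ i, Measurable (ψ i)) {M : ℝ} (hM : ∀ i z, |ψ i z| ≤ M) :
    ∫ S, ⨆ i, (∫ z, ψ i z ∂D - (m : ℝ)⁻¹ * ∑ j, ψ i (S j)) ∂(Measure.pi fun _ : Fin m => D) ≤
      2 * ∫ S, 𝔼 ε : Fin m → ℤˣ, ⨆ i, (m : ℝ)⁻¹ * ∑ j, ((ε j : ℤ) : ℝ) * ψ i (S j)
        ∂(Measure.pi fun _ : Fin m => D) := by
  obtain ⟨z₀⟩ := nonempty_of_isProbabilityMeasure D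
  obtain ⟨i₀⟩ := ‹Nonempty I›
  have : Nonempty I := ⟨i₀⟩
  have hM0 : 0 ≤ M := (abs_nonneg _).trans (hM i₀ z₀)
  refine (integral_iSup_deviation_le_ghost D hm hψ hM).trans ?_
  set P := Measure.pi fun _ : Fin m => D with hP
  set Q := Measure.pi fun _ : Fin m => D.prod D with hQ
  set R : (Fin m → ℤˣ) → (Fin m → Z) → ℝ :=
    fun ε S => ⨆ i, (m : ℝ)⁻¹ * ∑ j, ((ε j : ℤ) : ℝ) * ψ i (S j) with hR
  have hterm : ∀ ε : Fin m → ℤˣ, ∀ i, Measurable fun S : Fin m → Z =>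
      (m : ℝ)⁻¹ * ∑ j, ((ε j : ℤ) : ℝ) * ψ i (S j) := fun ε i => by
    have := hψ i
    fun_prop
  have hRm : ∀ ε, Measurable (R ε) := fun ε => Measurable.iSup (hterm ε)
  have hRb : ∀ ε S, |R ε S| ≤ M := fun ε S => abs_iSup_le_of_finite fun i =>
    abs_average_le hM0 fun j => (abs_sign_mul _ _).trans_le (hM i _)
  have hfst : MeasurePreserving (fun (W : Fin m → Z × Z) j => (W j).1) Q P :=
    measurePreserving_pi (fun _ => D.prod D) (fun _ => D) fun _ => measurePreserving_fst
  have hsnd : MeasurePreserving (fun (W : Fin m → Z × Z) j => (W j).2) Q P :=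
    measurePreserving_pi (fun _ => D.prod D) (fun _ => D) fun _ => measurePreserving_snd
  have hdev : ∀ ε : Fin m → ℤˣ, ∀ i, Measurable fun W : Fin m → Z × Z =>
      (m : ℝ)⁻¹ * ∑ j, ((ε j : ℤ) : ℝ) * (ψ i (W j).2 - ψ i (W j).1) := fun ε i => by
    have := hψ i
    fun_prop
  have hdevb : ∀ (ε : Fin m → ℤˣ) i (W : Fin m → Z × Z),
      |(m : ℝ)⁻¹ * ∑ j, ((ε j : ℤ) : ℝ) * (ψ i (W j).2 - ψ i (W j).1)| ≤ 2 * M := fun ε i W => by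
    refine abs_average_le (by positivity) fun j => (abs_sign_mul _ _).trans_le ?_
    linarith [abs_sub (ψ i (W j).2) (ψ i (W j).1), hM i (W j).1, hM i (W j).2]
  have hswap : ∀ ε : Fin m → ℤˣ,
      ∫ W, ⨆ i, (m : ℝ)⁻¹ * ∑ j, (ψ i (W j).2 - ψ i (W j).1) ∂Q =
        ∫ W, ⨆ i, (m : ℝ)⁻¹ * ∑ j, ((ε j : ℤ) : ℝ) * (ψ i (W j).2 - ψ i (W j).1) ∂Q := by
    intro ε
    -- Exchanging the two entries of the pairs with sign `-1` preserves the law and multiplies those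
    -- differences by `-1`.
    have hT : MeasurePreserving
        (fun (W : Fin m → Z × Z) j => (if ε j = 1 then id else Prod.swap) (W j)) Q Q :=
      measurePreserving_pi (fun _ => D.prod D) (fun _ => D.prod D) fun j => by
        split_ifs
        · exact MeasurePreserving.id _
        · exact Measure.measurePreserving_swap
    rw [← integral_comp_of_measurePreserving hT]
    · refine integral_congr_ae (ae_of_all _ fun W => ?_)
      simp only
      congr 1
      ext i
      congr 1
      refine Finset.sum_congr rfl fun j _ => ?_
      rcases Int.units_eq_one_or (ε j) with h | h <;> simp [h]
    · exact Measurable.iSup fun i => by simpa using hdev 1 i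
  have hle : ∀ ε : Fin m → ℤˣ,
      ∫ W, ⨆ i, (m : ℝ)⁻¹ * ∑ j, ((ε j : ℤ) : ℝ) * (ψ i (W j).2 - ψ i (W j).1) ∂Q ≤
        ∫ S, R ε S ∂P + ∫ S, R (-ε) S ∂P := by
    intro ε
    rw [← integral_comp_of_measurePreserving hsnd (hRm ε),
      ← integral_comp_of_measurePreserving hfst (hRm (-ε)), ← integral_add]
    · refine integral_mono (integrable_iSup_of_abs_le (hdev ε) (hdevb ε)) ?_ fun W => ?_
      · exact (integrable_of_abs_le ((hRm ε).comp hsnd.measurable) fun _ => hRb _ _).add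
          (integrable_of_abs_le ((hRm (-ε)).comp hfst.measurable) fun _ => hRb _ _)
      · refine ciSup_le fun i => ?_
        have h1 := le_iSup_of_finite
          (fun i => (m : ℝ)⁻¹ * ∑ j, ((ε j : ℤ) : ℝ) * ψ i (W j).2) i
        have h2 := le_iSup_of_finite
          (fun i => (m : ℝ)⁻¹ * ∑ j, (((-ε) j : ℤ) : ℝ) * ψ i (W j).1) i
        refine le_trans (le_of_eq ?_) (add_le_add h1 h2)
        rw [← mul_add, ← Finset.sum_add_distrib]
        congr 1
        refine Finset.sum_congr rfl fun j _ => ?_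
        simp
        ring
    · exact integrable_of_abs_le ((hRm ε).comp hsnd.measurable) fun _ => hRb _ _
    · exact integrable_of_abs_le ((hRm (-ε)).comp hfst.measurable) fun _ => hRb _ _
  have hneg : 𝔼 ε : Fin m → ℤˣ, ∫ S, R (-ε) S ∂P = 𝔼 ε : Fin m → ℤˣ, ∫ S, R ε S ∂P :=
    Fintype.expect_equiv (Equiv.neg (Fin m → ℤˣ)) _ _ fun ε => rfl
  have hcomm : ∫ S, 𝔼 ε : Fin m → ℤˣ, R ε S ∂P = 𝔼 ε : Fin m → ℤˣ, ∫ S, R ε S ∂P := by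
    simp only [Fintype.expect_eq_sum_div_card]
    rw [integral_div, integral_finsetSum]
    exact fun ε _ => integrable_of_abs_le (hRm ε) (hRb ε)
  calc ∫ W, ⨆ i, (m : ℝ)⁻¹ * ∑ j, (ψ i (W j).2 - ψ i (W j).1) ∂Q
      = 𝔼 _ε : Fin m → ℤˣ, ∫ W, ⨆ i, (m : ℝ)⁻¹ * ∑ j, (ψ i (W j).2 - ψ i (W j).1) ∂Q :=
        (Fintype.expect_const _).symm
    _ ≤ 𝔼 ε : Fin m → ℤˣ, (∫ S, R ε S ∂P + ∫ S, R (-ε) S ∂P) :=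
        Finset.expect_le_expect fun ε _ => (hswap ε).trans_le (hle ε)
    _ = 2 * ∫ S, 𝔼 ε : Fin m → ℤˣ, R ε S ∂P := by
        rw [Finset.expect_add_distrib, hneg, hcomm]
        ring

/-- A uniform deviation bound for a finite class of functions with values in `[0, M]`, in terms of
its expected Rademacher average. -/
theorem measure_exists_deviation_le (D : Measure Z) [IsProbabilityMeasure D] {m : ℕ}
    (hm : 1 ≤ m) {ψ : I → Z → ℝ} (hψ : ∀ i, Measurable (ψ i)) {M : ℝ} (hM : 0 < M)
    (hψM : ∀ i z, ψ i z ∈ Set.Icc 0 M) {A : ℝ}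
    (hA : 2 * ∫ S, 𝔼 ε : Fin m → ℤˣ, ⨆ i, (m : ℝ)⁻¹ * ∑ j, ((ε j : ℤ) : ℝ) * ψ i (S j)
        ∂(Measure.pi fun _ : Fin m => D) ≤ A) {δ : ℝ} (hδ : 0 < δ) (hδ1 : δ ≤ 1) :
    (Measure.pi fun _ : Fin m => D) {S | ∃ i, A + M * √(Real.log (1 / δ) / (2 * m)) <
      ∫ z, ψ i z ∂D - (m : ℝ)⁻¹ * ∑ j, ψ i (S j)} ≤ ENNReal.ofReal δ := by
  have hψa : ∀ i z, |ψ i z| ≤ M := fun i z => abs_le.2 ⟨by linarith [(hψM i z).1], (hψM i z).2⟩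
  have hm0 : (0 : ℝ) < m := by exact_mod_cast hm
  set P := Measure.pi fun _ : Fin m => D with hP
  set f : (Fin m → Z) → ℝ := fun S => ⨆ i, (∫ z, ψ i z ∂D - (m : ℝ)⁻¹ * ∑ j, ψ i (S j)) with hf
  set t := M * √(Real.log (1 / δ) / (2 * m)) with ht
  have hfm : Measurable f := Measurable.iSup fun i => by
    have := hψ i
    fun_prop
  have hfC : ∀ S, |f S| ≤ 2 * M := fun S => abs_iSup_le_of_finite fun i => by
    have h1 : |∫ z, ψ i z ∂D| ≤ M := abs_integral_le_of_abs_le (hψa i)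
    have h2 := abs_average_le hM.le fun j => hψa i (S j)
    linarith [abs_sub (∫ z, ψ i z ∂D) ((m : ℝ)⁻¹ * ∑ j, ψ i (S j))]
  have hfc : ∀ S i z, f (Function.update S i z) - f S ≤ M / m := by
    intro S k z
    rw [sub_le_iff_le_add']
    refine ciSup_le fun i => ?_
    have h1 := le_iSup_of_finite (fun i => ∫ z, ψ i z ∂D - (m : ℝ)⁻¹ * ∑ j, ψ i (S j)) i
    have h2 : ∑ j, ψ i (S j) - M ≤ ∑ j, ψ i (Function.update S k z j) := by
      rw [← Finset.add_sum_erase _ _ (Finset.mem_univ k),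
        ← Finset.add_sum_erase _ (fun j => ψ i (Function.update S k z j)) (Finset.mem_univ k)]
      have h3 : ∑ j ∈ Finset.univ.erase k, ψ i (Function.update S k z j) =
          ∑ j ∈ Finset.univ.erase k, ψ i (S j) :=
        Finset.sum_congr rfl fun j hj => by
          rw [Function.update_of_ne (Finset.ne_of_mem_erase hj)]
      rw [h3, Function.update_self]
      linarith [(hψM i z).1, (hψM i (S k)).2]
    have h4 := mul_le_mul_of_nonneg_left h2 (inv_pos.2 hm0).le
    rw [mul_sub] at h4
    have h5 : (m : ℝ)⁻¹ * M = M / m := by rw [div_eq_inv_mul]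
    simp only [hf] at h1 ⊢
    linarith
  have hlog : 0 ≤ Real.log (1 / δ) := Real.log_nonneg (by rw [le_div_iff₀ hδ]; linarith)
  have ht0 : 0 ≤ t := by positivity
  have htail := measure_ge_le_of_bounded_differences D hfm hfC hfc ht0
  -- The threshold `t` is the one that makes McDiarmid's tail with differences `M / m` equal to `δ`.
  have hexp : Real.exp (-2 * t ^ 2 / (m * (M / m) ^ 2)) = δ := by
    have : -2 * t ^ 2 / (m * (M / m) ^ 2) = Real.log δ := by
      rw [ht, mul_pow, Real.sq_sqrt (by positivity), one_div, Real.log_inv]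
      field_simp
    rw [this, Real.exp_log hδ]
  rw [hexp] at htail
  have hE : ∫ S, f S ∂P ≤ A := (integral_iSup_deviation_le D hm hψ hψa).trans hA
  refine (measure_mono fun S hS => ?_).trans
    ((ENNReal.le_ofReal_iff_toReal_le (measure_ne_top _ _) hδ.le).2 htail)
  obtain ⟨i, hi⟩ := hS
  have h1 := le_iSup_of_finite (fun i => ∫ z, ψ i z ∂D - (m : ℝ)⁻¹ * ∑ j, ψ i (S j)) i
  simp only [Set.mem_ofPred_eq, hf] at *
  linarith

end Symmetrization

universe u v

/-! ### Margin losses -/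

/-- The clipped margin loss with weights `b`: the additive margin loss is the case `b = 1 / ρ` and
the multiplicative one the case `b = L / ρ`. -/
noncomputable def marginLoss {X : Type u} {Y : Type v} (L b : Y → Y → ℝ) (ρ τ : ℝ)
    (s : X → Y → ℝ) (z : X × Y) : ℝ :=
  clip (maxLoss L) (⨆ y' : {y' // y' ≠ z.2},
    (L y' z.2 + b y' z.2 * (τ * ρ - (s z.1 z.2 - s z.1 y'))))

section MarginLoss

variable {X : Type u} {Y : Type v}

lemma empAddLoss_eq (L : Y → Y → ℝ) {ρ : ℝ} (hρ : 0 < ρ) (τ : ℝ) {m : ℕ} (S : Fin m → X × Y)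
    (s : X → Y → ℝ) :
    empAddLoss L ρ τ S s = (m : ℝ)⁻¹ * ∑ i, marginLoss L (fun _ _ => 1 / ρ) ρ τ s (S i) := by
  simp only [empAddLoss, marginLoss]
  congr 1
  refine Finset.sum_congr rfl fun i _ => ?_
  congr 1
  refine iSup_congr fun y' => ?_
  field_simp
  ring

lemma empMultLoss_eq (L : Y → Y → ℝ) {ρ : ℝ} (hρ : 0 < ρ) (τ : ℝ) {m : ℕ} (S : Fin m → X × Y)
    (s : X → Y → ℝ) :
    empMultLoss L ρ τ S s =
      (m : ℝ)⁻¹ * ∑ i, marginLoss L (fun y y' => L y y' / ρ) ρ τ s (S i) := by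
  simp only [empMultLoss, marginLoss]
  congr 1
  refine Finset.sum_congr rfl fun i _ => ?_
  congr 1
  refine iSup_congr fun y' => ?_
  field_simp
  ring

lemma clip_mem_Icc {M : ℝ} (hM : 0 ≤ M) (r : ℝ) : clip M r ∈ Set.Icc 0 M :=
  ⟨le_min hM (le_max_left _ _), min_le_left _ _⟩

lemma clip_mono (M : ℝ) : Monotone (clip M) := fun _ _ h =>
  min_le_min le_rfl (max_le_max le_rfl h)

lemma abs_clip_sub_clip_le (M r r' : ℝ) : |clip M r - clip M r'| ≤ |r - r'| := by
  refine (abs_min_sub_min_le_max _ _ _ _).trans ?_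
  rw [sub_self, abs_zero, max_eq_right (abs_nonneg _)]
  refine (abs_max_sub_max_le_max _ _ _ _).trans ?_
  rw [sub_self, abs_zero, max_eq_right (abs_nonneg _)]

lemma abs_iSup_sub_iSup_le {ι : Type*} [Finite ι] {f g : ι → ℝ} {r : ℝ} (hr : 0 ≤ r)
    (h : ∀ i, |f i - g i| ≤ r) : |(⨆ i, f i) - ⨆ i, g i| ≤ r := by
  -- If there is only one label there are no competitors, and both real suprema over the empty type
  -- are 0.
  rcases isEmpty_or_nonempty ι with hι | hι
  · simpa [Real.iSup_of_isEmpty] using hr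
  · rw [abs_sub_le_iff]
    constructor
    · rw [sub_le_iff_le_add]
      exact ciSup_le fun i => by linarith [(abs_le.1 (h i)).2, le_iSup_of_finite g i]
    · rw [sub_le_iff_le_add]
      exact ciSup_le fun i => by linarith [(abs_le.1 (h i)).1, le_iSup_of_finite f i]

lemma maxLoss_nonneg {L : Y → Y → ℝ} (hL : IsLoss L) : 0 ≤ maxLoss L :=
  Real.iSup_nonneg fun _ => hL.nonneg _ _

lemma marginLoss_mem_Icc {L : Y → Y → ℝ} (hL : IsLoss L) (b : Y → Y → ℝ) (ρ τ : ℝ)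
    (s : X → Y → ℝ) (z : X × Y) : marginLoss L b ρ τ s z ∈ Set.Icc 0 (maxLoss L) :=
  clip_mem_Icc (maxLoss_nonneg hL) _

variable [Fintype Y]

lemma le_maxLoss (L : Y → Y → ℝ) (y y' : Y) : L y y' ≤ maxLoss L :=
  le_iSup_of_finite (fun q : Y × Y => L q.1 q.2) (y, y')

/-- Clipping and finite suprema are 1-Lipschitz. Each margin is a difference of two scores, whence
the factor 2. -/
lemma abs_marginLoss_sub_le (L : Y → Y → ℝ) {b : Y → Y → ℝ} {B : ℝ} (hb : ∀ y y', |b y y'| ≤ B)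
    (ρ τ : ℝ) {s s' : X → Y → ℝ} {z : X × Y} {r : ℝ} (h : ∀ y, |s z.1 y - s' z.1 y| ≤ r) :
    |marginLoss L b ρ τ s z - marginLoss L b ρ τ s' z| ≤ 2 * B * r := by
  have hB : 0 ≤ B := (abs_nonneg _).trans (hb z.2 z.2)
  have hr : 0 ≤ r := (abs_nonneg _).trans (h z.2)
  refine (abs_clip_sub_clip_le _ _ _).trans (abs_iSup_sub_iSup_le (by positivity) fun y' => ?_)
  have e : L y' z.2 + b y' z.2 * (τ * ρ - (s z.1 z.2 - s z.1 y')) -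
      (L y' z.2 + b y' z.2 * (τ * ρ - (s' z.1 z.2 - s' z.1 y'))) =
      b y' z.2 * ((s z.1 y' - s' z.1 y') - (s z.1 z.2 - s' z.1 z.2)) := by ring
  rw [e, abs_mul]
  calc _ ≤ B * (r + r) := mul_le_mul (hb _ _)
        ((abs_sub _ _).trans (add_le_add (h _) (h _))) (abs_nonneg _) hB
    _ = _ := by ring

lemma measurable_marginLoss [MeasurableSpace X] [MeasurableSpace Y] [MeasurableSingletonClass Y]
    (L b : Y → Y → ℝ) (ρ τ : ℝ) {s : X → Y → ℝ} (hs : ∀ y, Measurable fun x => s x y) :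
    Measurable (marginLoss L b ρ τ s) := by
  refine measurable_from_prod_countable_left fun y => ?_
  change Measurable fun x => min (maxLoss L) (max 0 (⨆ y' : {y' // y' ≠ y},
    (L y' y + b y' y * (τ * ρ - (s x y - s x y')))))
  refine measurable_const.min (measurable_const.max (Measurable.iSup fun y' => ?_))
  have h1 := hs y
  have h2 := hs y'
  fun_prop

lemma tendsto_marginLoss (L : Y → Y → ℝ) (b : Y → Y → ℝ) (ρ τ : ℝ)
    {s : ℕ → X → Y → ℝ} {s' : X → Y → ℝ}
    (h : ∀ x y, Tendsto (fun n => s n x y) atTop (𝓝 (s' x y))) (z : X × Y) :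
    Tendsto (fun n => marginLoss L b ρ τ (s n) z) atTop (𝓝 (marginLoss L b ρ τ s' z)) := by
  have hb : ∀ y y', |b y y'| ≤ ⨆ q : Y × Y, |b q.1 q.2| := fun y y' =>
    le_iSup_of_finite (fun q : Y × Y => |b q.1 q.2|) (y, y')
  rw [tendsto_iff_dist_tendsto_zero]
  refine squeeze_zero (fun _ => dist_nonneg) (fun n => ?_)
    (g := fun n => 2 * (⨆ q : Y × Y, |b q.1 q.2|) * ∑ y, |s n z.1 y - s' z.1 y|) ?_
  · rw [Real.dist_eq]
    exact abs_marginLoss_sub_le L hb ρ τ fun y =>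
      Finset.single_le_sum (f := fun y => |s n z.1 y - s' z.1 y|) (fun _ _ => abs_nonneg _)
        (Finset.mem_univ y)
  · have h0 : Tendsto (fun n => ∑ y, |s n z.1 y - s' z.1 y|) atTop (𝓝 (∑ _y : Y, (0 : ℝ))) :=
      tendsto_finsetSum _ fun y _ => by
        simpa using ((h z.1 y).sub_const (s' z.1 y)).abs
    simpa using h0.const_mul (2 * ⨆ q : Y × Y, |b q.1 q.2|)

end MarginLoss

/-! ### The Rademacher average of the margin losses of a finite class of ensembles -/

section FiniteClass

variable {X : Type u} {Y : Type v} {G : X × Y → OutputGraph Y}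

/-- The uniform average of scoring functions. -/
noncomputable abbrev average {n : ℕ} (w : Fin n → ScoringFunction G) : X → Y → ℝ :=
  ensemble (fun _ => (n : ℝ)⁻¹) w

lemma measurable_ensemble [MeasurableSpace X] {T : ℕ} {α : Fin T → ℝ} {h : Fin T → ScoringFunction G}
    (hh : ∀ t y, Measurable fun x => (h t).score x y) (y : Y) :
    Measurable fun x => ensemble α h x y := by
  have := fun t => hh t y
  unfold ensemble
  fun_prop

/-- Cauchy–Schwarz over the factors, followed by enlarging the single label `y_f` to all labels of
each factor. This is the source of the weights `√|F_i|` in the complexity. -/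
lemma abs_sum_restrict_le (Γ : OutputGraph Y) (a : ∀ f : Γ.Factor, Γ.FactorLabel f → ℝ) (y : Y) :
    |∑ f, a f (Γ.restrict f y)| ≤
      √(∑ j : Σ f : Γ.Factor, Γ.FactorLabel f,
        (√(Fintype.card Γ.Factor : ℝ) * a j.1 j.2) ^ 2) := by
  refine Real.abs_le_sqrt ?_
  calc (∑ f, a f (Γ.restrict f y)) ^ 2
      ≤ (Fintype.card Γ.Factor : ℝ) * ∑ f, a f (Γ.restrict f y) ^ 2 := sq_sum_le_card_mul_sum_sq
    _ ≤ (Fintype.card Γ.Factor : ℝ) * ∑ f, ∑ y', a f y' ^ 2 := by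
        gcongr with f
        exact Finset.single_le_sum (f := fun y' => a f y' ^ 2) (fun _ _ => sq_nonneg _)
          (Finset.mem_univ _)
    _ = _ := by
        rw [Fintype.sum_sigma]
        simp only [mul_pow, Real.sq_sqrt (Nat.cast_nonneg _), Finset.mul_sum]

lemma coe_sum_ereal {ι : Type*} (s : Finset ι) (f : ι → ℝ) :
    ((∑ i ∈ s, f i : ℝ) : EReal) = ∑ i ∈ s, (f i : EReal) := by
  classical
  induction s using Finset.induction_on with
  | empty => simp
  | insert a s ha ih => rw [Finset.sum_insert ha, Finset.sum_insert ha, EReal.coe_add, ih]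

lemma card_sign_fun {J : Type*} [Fintype J] [DecidableEq J] :
    Fintype.card (J → ℤˣ) = 2 ^ Fintype.card J := by
  rw [Fintype.card_fun, Fintype.card_units_int]

open Classical in
lemma ofReal_expect_le_empComplexity {H : Set (ScoringFunction G)} {m : ℕ} {I : Type*} [Finite I]
    [Nonempty I] {w : I → ScoringFunction G} (hw : ∀ i, w i ∈ H) (S : Fin m → X × Y) :
    ENNReal.ofReal ((m : ℝ)⁻¹ * 𝔼 ε : SignIndex G S → ℤˣ, ⨆ i, signedSum S ε (w i)) ≤
      (empComplexity H S).toENNReal := by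
  rw [← EReal.real_coe_toENNReal]
  refine EReal.toENNReal_le_toENNReal ?_
  rw [EReal.coe_mul]
  refine mul_le_mul_of_nonneg_left ?_ (by exact_mod_cast (by positivity : (0 : ℝ) ≤ (m : ℝ)⁻¹))
  rw [Fintype.expect_eq_sum_div_card, Finset.sum_div]
  rw [coe_sum_ereal]
  refine Finset.sum_le_sum (N := EReal) fun ε _ => ?_
  rw [card_sign_fun, div_eq_inv_mul, EReal.coe_mul, Nat.cast_pow, Nat.cast_ofNat]
  refine mul_le_mul_of_nonneg_left ?_ (by exact_mod_cast (by positivity))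
  -- Over a finite class the real supremum is attained, so it is one of the terms of the extended
  -- supremum over `H`.
  obtain ⟨i, hi⟩ := exists_eq_ciSup_of_finite (f := fun i => signedSum S ε (w i))
  rw [← hi]
  exact le_iSup₂_of_le (w i) (hw i) le_rfl

variable [Fintype Y]

lemma abs_marginLoss_average_sub_le (L : Y → Y → ℝ) {b : Y → Y → ℝ} {B : ℝ}
    (hb : ∀ y y', |b y y'| ≤ B) (ρ τ : ℝ) {n : ℕ} (w w' : Fin n → ScoringFunction G) (z : X × Y) :
    |marginLoss L b ρ τ (average w) z - marginLoss L b ρ τ (average w') z| ≤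
      2 * B * √(∑ j : Σ f : (G z).Factor, (G z).FactorLabel f,
        (√(Fintype.card (G z).Factor : ℝ) * ∑ l, (n : ℝ)⁻¹ * (w l).factor z j.1 j.2 -
          √(Fintype.card (G z).Factor : ℝ) * ∑ l, (n : ℝ)⁻¹ * (w' l).factor z j.1 j.2) ^ 2) := by
  refine abs_marginLoss_sub_le L hb ρ τ fun y => ?_
  have h := abs_sum_restrict_le (G z) (fun f y => ∑ l, (n : ℝ)⁻¹ * (w l).factor z f y -
    ∑ l, (n : ℝ)⁻¹ * (w' l).factor z f y) y
  simp only [mul_sub] at h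
  refine le_trans (le_of_eq ?_) h
  congr 1
  simp only [ensemble, ScoringFunction.score_eq _ z, Finset.mul_sum, Finset.sum_sub_distrib]
  exact congrArg₂ _ Finset.sum_comm Finset.sum_comm

open Classical in
/-- The Rademacher average of the margin losses of averages of scoring functions is controlled by
the factor graph Rademacher averages of the components. -/
lemma expect_iSup_marginLoss_le (L : Y → Y → ℝ) {b : Y → Y → ℝ} {B : ℝ} (hB : 0 ≤ B)
    (hb : ∀ y y', |b y y'| ≤ B) (ρ τ : ℝ) {n m : ℕ} {I : Type*} [Finite I] [Nonempty I]
    (w : I → Fin n → ScoringFunction G) (S : Fin m → X × Y) :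
    𝔼 ε : Fin m → ℤˣ, ⨆ i, (m : ℝ)⁻¹ * ∑ j, ((ε j : ℤ) : ℝ) *
        marginLoss L b ρ τ (average (w i)) (S j) ≤
      2 * √2 * B * ((n : ℝ)⁻¹ * ∑ l, (m : ℝ)⁻¹ *
        𝔼 ε : SignIndex G S → ℤˣ, ⨆ i, signedSum S ε (w i l)) := by
  have hc := vector_contraction (m := m)
    (J := fun j => Σ f : (G (S j)).Factor, (G (S j)).FactorLabel f) (fun _ : I => (0 : ℝ))
    (fun j i => marginLoss L b ρ τ (average (w i)) (S j))
    (fun j i q => √(Fintype.card (G (S j)).Factor : ℝ) *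
      ∑ l, (n : ℝ)⁻¹ * (w i l).factor (S j) q.1 q.2) (K := 2 * B) (by positivity)
    (fun j i i' => abs_marginLoss_average_sub_le L hb ρ τ (w i) (w i') (S j))
  simp only [zero_add] at hc
  have hsum : ∀ (e : SignIndex G S → ℤˣ) (i : I),
      ∑ j, ∑ q : Σ f : (G (S j)).Factor, (G (S j)).FactorLabel f, ((e ⟨j, q⟩ : ℤ) : ℝ) *
        (√(Fintype.card (G (S j)).Factor : ℝ) *
          ∑ l, (n : ℝ)⁻¹ * (w i l).factor (S j) q.1 q.2) =
      (n : ℝ)⁻¹ * ∑ l, signedSum S e (w i l) := by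
    intro e i
    simp only [signedSum, Fintype.sum_sigma, Finset.mul_sum]
    rw [Finset.sum_comm (γ := Fin n)]
    refine Finset.sum_congr rfl fun j _ => ?_
    rw [Finset.sum_comm (γ := Fin n)]
    refine Finset.sum_congr rfl fun f _ => ?_
    rw [Finset.sum_comm (γ := Fin n)]
    refine Finset.sum_congr rfl fun y _ => Finset.sum_congr rfl fun l _ => ?_
    ring
  have hcurry : 𝔼 e : (∀ j : Fin m, (Σ f : (G (S j)).Factor, (G (S j)).FactorLabel f) → ℤˣ),
      ⨆ i, √2 * (2 * B) * ∑ j, ∑ q, ((e j q : ℤ) : ℝ) *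
        (√(Fintype.card (G (S j)).Factor : ℝ) *
          ∑ l, (n : ℝ)⁻¹ * (w i l).factor (S j) q.1 q.2) =
      𝔼 e : SignIndex G S → ℤˣ, ⨆ i, √2 * (2 * B) * ((n : ℝ)⁻¹ * ∑ l, signedSum S e (w i l)) := by
    refine (Fintype.expect_equiv (Equiv.piCurry (fun (j : Fin m)
      (_ : Σ f : (G (S j)).Factor, (G (S j)).FactorLabel f) => ℤˣ)) _ _ fun e => ?_).symm
    simp only [← hsum]
    rfl
  rw [hcurry] at hc
  have hm0 : (0 : ℝ) ≤ (m : ℝ)⁻¹ := by positivity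
  have hn0 : (0 : ℝ) ≤ (n : ℝ)⁻¹ := by positivity
  calc _ = (m : ℝ)⁻¹ * 𝔼 ε : Fin m → ℤˣ, ⨆ i, ∑ j, ((ε j : ℤ) : ℝ) *
        marginLoss L b ρ τ (average (w i)) (S j) := by
        simp only [← Real.mul_iSup_of_nonneg hm0, ← Finset.mul_expect]
    _ ≤ (m : ℝ)⁻¹ * 𝔼 e : SignIndex G S → ℤˣ, √2 * (2 * B) * ((n : ℝ)⁻¹ * ∑ l,
          ⨆ i, signedSum S e (w i l)) := by
        refine mul_le_mul_of_nonneg_left (hc.trans (Finset.expect_le_expect fun e _ => ?_)) hm0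
        -- The supremum of a sum is at most the sum of the suprema, which separates the members so
        -- that each family contributes its own complexity.
        refine ciSup_le fun i => ?_
        gcongr with l
        exact le_iSup_of_finite (fun i => signedSum S e (w i l)) i
    _ = _ := by
        rw [← Finset.mul_expect, ← Finset.mul_expect, Finset.expect_sum_comm, ← Finset.mul_sum]
        ring

end FiniteClass

/-! ### Uniform deviation bounds for averages of scoring functions -/

section Deviation

variable {X : Type u} {Y : Type v} [MeasurableSpace X] [MeasurableSpace Y]
  {G : X × Y → OutputGraph Y}

/-- The difference between the expected and the empirical margin loss. -/
noncomputable def deviation (D : Measure (X × Y)) (L b : Y → Y → ℝ) (ρ τ : ℝ) {m : ℕ}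
    (S : Fin m → X × Y) (s : X → Y → ℝ) : ℝ :=
  ∫ z, marginLoss L b ρ τ s z ∂D - (m : ℝ)⁻¹ * ∑ j, marginLoss L b ρ τ s (S j)

/-- The complexity term of the class of averages of `n` scoring functions from `H 1, …, H n`. -/
noncomputable def averageComplexity (D : Measure (X × Y)) (m : ℕ) (B : ℝ) {n : ℕ}
    (H : Fin n → Set (ScoringFunction G)) : ℝ≥0∞ :=
  ENNReal.ofReal (4 * √2 * B) * (ENNReal.ofReal (n : ℝ)⁻¹ * ∑ l, complexity D m (H l))

/-- No integrability is needed, because the integral of a non-integrable function is 0 by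
convention. -/
lemma ofReal_integral_le_lintegral {Ω : Type*} [MeasurableSpace Ω] {μ : Measure Ω} (f : Ω → ℝ) :
    ENNReal.ofReal (∫ x, f x ∂μ) ≤ ∫⁻ x, ENNReal.ofReal (f x) ∂μ := by
  by_cases hf : Integrable f μ
  · rw [integral_eq_lintegral_pos_part_sub_lintegral_neg_part hf]
    exact (ENNReal.ofReal_le_ofReal (sub_le_self _ ENNReal.toReal_nonneg)).trans
      ENNReal.ofReal_toReal_le
  · simp [integral_undef hf]

variable [Fintype Y]

lemma two_mul_integral_expect_le (D : Measure (X × Y)) {L b : Y → Y → ℝ} {B : ℝ} (hB : 0 ≤ B)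
    (hb : ∀ y y', |b y y'| ≤ B) (ρ τ : ℝ) {n m : ℕ} (H : Fin n → Set (ScoringFunction G))
    (hH : ∀ l, AEMeasurable (fun S : Fin m → X × Y => empComplexity (H l) S) (sampleLaw D m))
    {I : Type*} [Finite I] [Nonempty I] {w : I → Fin n → ScoringFunction G}
    (hw : ∀ i l, w i l ∈ H l) :
    ENNReal.ofReal (2 * ∫ S, 𝔼 ε : Fin m → ℤˣ, ⨆ i, (m : ℝ)⁻¹ * ∑ j, ((ε j : ℤ) : ℝ) *
      marginLoss L b ρ τ (average (w i)) (S j) ∂(sampleLaw D m)) ≤ averageComplexity D m B H := by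
  classical
  have hpt : ∀ S : Fin m → X × Y, ENNReal.ofReal (2 * 𝔼 ε : Fin m → ℤˣ, ⨆ i, (m : ℝ)⁻¹ *
      ∑ j, ((ε j : ℤ) : ℝ) * marginLoss L b ρ τ (average (w i)) (S j)) ≤
      ENNReal.ofReal (4 * √2 * B) * (ENNReal.ofReal (n : ℝ)⁻¹ *
        ∑ l, (empComplexity (H l) S).toENNReal) := by
    intro S
    have h1 := expect_iSup_marginLoss_le L hB hb ρ τ w S
    have h2 := mul_le_mul_of_nonneg_left h1 (zero_le_two (α := ℝ))
    refine (ENNReal.ofReal_le_ofReal (h2.trans_eq (by ring :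
      _ = 4 * √2 * B * ((n : ℝ)⁻¹ * ∑ l, (m : ℝ)⁻¹ *
        𝔼 ε : SignIndex G S → ℤˣ, ⨆ i, signedSum S ε (w i l))))).trans ?_
    rw [ENNReal.ofReal_mul (p := 4 * √2 * B) (by positivity),
      ENNReal.ofReal_mul (p := (n : ℝ)⁻¹) (by positivity)]
    gcongr
    refine (Finset.le_sum_of_subadditive _ ENNReal.ofReal_zero.le
      (fun _ _ => ENNReal.ofReal_add_le) _ _).trans (Finset.sum_le_sum fun l _ => ?_)
    convert ofReal_expect_le_empComplexity (fun i => hw i l) S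
  rw [← integral_const_mul]
  refine (ofReal_integral_le_lintegral _).trans ((lintegral_mono hpt).trans_eq ?_)
  -- The a.e. measurability of the empirical complexities serves to exchange the integral with the
  -- sum over the families.
  rw [lintegral_const_mul' _ _ ENNReal.ofReal_ne_top,
    lintegral_const_mul' _ _ ENNReal.ofReal_ne_top,
    lintegral_finsetSum' _ fun l _ => (hH l).ereal_toENNReal]
  rfl

variable [MeasurableSingletonClass Y]

lemma measure_exists_deviation_finite_le (D : Measure (X × Y)) [IsProbabilityMeasure D]
    {L b : Y → Y → ℝ} (hL : IsLoss L) (hM : 0 < maxLoss L) {B : ℝ} (hB : 0 ≤ B)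
    (hb : ∀ y y', |b y y'| ≤ B) (ρ τ : ℝ) {n m : ℕ} (hm : 1 ≤ m)
    (H : Fin n → Set (ScoringFunction G))
    (hH : ∀ l, AEMeasurable (fun S : Fin m → X × Y => empComplexity (H l) S) (sampleLaw D m))
    (hHm : ∀ l, ∀ h ∈ H l, ∀ y, Measurable fun x => h.score x y)
    {I : Type*} [Finite I] {w : I → Fin n → ScoringFunction G}
    (hw : ∀ i l, w i l ∈ H l) {δ : ℝ} (hδ : 0 < δ) (hδ1 : δ ≤ 1) :
    sampleLaw D m {S | ∃ i, averageComplexity D m B H +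
        ENNReal.ofReal (maxLoss L * √(Real.log (1 / δ) / (2 * m))) <
      ENNReal.ofReal (deviation D L b ρ τ S (average (w i)))} ≤ ENNReal.ofReal δ := by
  rcases isEmpty_or_nonempty I with hI | hI
  · simp
  -- With infinite complexity the strict inequality defining the bad event cannot hold.
  by_cases htop : averageComplexity D m B H = ⊤
  · simp [htop]
  have hA : 2 * ∫ S, 𝔼 ε : Fin m → ℤˣ, ⨆ i, (m : ℝ)⁻¹ * ∑ j, ((ε j : ℤ) : ℝ) *
      marginLoss L b ρ τ (average (w i)) (S j) ∂(sampleLaw D m) ≤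
        (averageComplexity D m B H).toReal :=
    (ENNReal.ofReal_le_iff_le_toReal htop).1 (two_mul_integral_expect_le D hB hb ρ τ H hH hw)
  refine (measure_mono ?_).trans (measure_exists_deviation_le D hm
    (fun i => measurable_marginLoss L b ρ τ
      (measurable_ensemble fun l y => hHm l _ (hw i l) y)) hM
    (fun i z => marginLoss_mem_Icc hL b ρ τ _ z) hA hδ hδ1)
  rintro S ⟨i, hi⟩
  refine ⟨i, ?_⟩
  rw [← ENNReal.ofReal_toReal htop, ← ENNReal.ofReal_add ENNReal.toReal_nonneg (by positivity)] at hi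
  exact (ENNReal.ofReal_lt_ofReal_iff_of_nonneg (by positivity)).1 hi

/-- The bound for finite classes does not depend on their size, so it survives the increasing union
of the bad events of the initial segments of an enumeration. -/
lemma measure_exists_deviation_countable_le (D : Measure (X × Y)) [IsProbabilityMeasure D]
    {L b : Y → Y → ℝ} (hL : IsLoss L) (hM : 0 < maxLoss L) {B : ℝ} (hB : 0 ≤ B)
    (hb : ∀ y y', |b y y'| ≤ B) (ρ τ : ℝ) {n m : ℕ} (hm : 1 ≤ m)
    (H : Fin n → Set (ScoringFunction G))
    (hH : ∀ l, AEMeasurable (fun S : Fin m → X × Y => empComplexity (H l) S) (sampleLaw D m))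
    (hHm : ∀ l, ∀ h ∈ H l, ∀ y, Measurable fun x => h.score x y)
    {W : Set (Fin n → ScoringFunction G)} (hWc : W.Countable) (hW : ∀ w ∈ W, ∀ l, w l ∈ H l)
    {δ : ℝ} (hδ : 0 < δ) (hδ1 : δ ≤ 1) :
    sampleLaw D m {S | ∃ w ∈ W, averageComplexity D m B H +
        ENNReal.ofReal (maxLoss L * √(Real.log (1 / δ) / (2 * m))) <
      ENNReal.ofReal (deviation D L b ρ τ S (average w))} ≤ ENNReal.ofReal δ := by
  rcases W.eq_empty_or_nonempty with rfl | hne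
  · simp
  obtain ⟨e, rfl⟩ := hWc.exists_eq_range hne
  set E : ℕ → Set (Fin m → X × Y) := fun N => {S | ∃ i : Fin N, averageComplexity D m B H +
        ENNReal.ofReal (maxLoss L * √(Real.log (1 / δ) / (2 * m))) <
      ENNReal.ofReal (deviation D L b ρ τ S (average (e i)))} with hE
  have hmono : Monotone E := fun N N' hN S ⟨i, hi⟩ => ⟨Fin.castLE hN i, hi⟩
  have hsub : {S | ∃ w ∈ Set.range e, averageComplexity D m B H +
        ENNReal.ofReal (maxLoss L * √(Real.log (1 / δ) / (2 * m))) <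
      ENNReal.ofReal (deviation D L b ρ τ S (average w))} ⊆ ⋃ N, E N := by
    rintro S ⟨_, ⟨i, rfl⟩, hi⟩
    exact Set.mem_iUnion.2 ⟨i + 1, ⟨i, Nat.lt_succ_self i⟩, hi⟩
  refine (measure_mono hsub).trans ?_
  rw [hmono.measure_iUnion]
  exact iSup_le fun N => measure_exists_deviation_finite_le D hL hM hB hb ρ τ hm H hH hHm
    (fun i l => hW _ ⟨_, rfl⟩ l) hδ hδ1

lemma tendsto_deviation (D : Measure (X × Y)) [IsProbabilityMeasure D]
    {L : Y → Y → ℝ} (hL : IsLoss L) (b : Y → Y → ℝ) (ρ τ : ℝ) {m : ℕ} (S : Fin m → X × Y)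
    {s : ℕ → X → Y → ℝ} {s' : X → Y → ℝ} (hs : ∀ n y, Measurable fun x => s n x y)
    (h : ∀ x y, Tendsto (fun n => s n x y) atTop (𝓝 (s' x y))) :
    Tendsto (fun n => deviation D L b ρ τ S (s n)) atTop (𝓝 (deviation D L b ρ τ S s')) := by
  refine Tendsto.sub ?_ ((tendsto_finsetSum _ fun j _ =>
    tendsto_marginLoss L b ρ τ h (S j)).const_mul _)
  refine tendsto_integral_of_dominated_convergence (fun _ => maxLoss L)
    (fun n => (measurable_marginLoss L b ρ τ (hs n)).aestronglyMeasurable) (integrable_const _)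
    (fun n => ae_of_all _ fun z => ?_) (ae_of_all _ fun z => tendsto_marginLoss L b ρ τ h z)
  have := marginLoss_mem_Icc hL b ρ τ (s n) z
  rw [Real.norm_eq_abs, abs_of_nonneg this.1]
  exact this.2

/-- The uniform deviation bound for averages of `n` scoring functions from fixed families. -/
lemma measure_exists_deviation_average_le (D : Measure (X × Y)) [IsProbabilityMeasure D]
    {L b : Y → Y → ℝ} (hL : IsLoss L) (hM : 0 < maxLoss L) {B : ℝ} (hB : 0 ≤ B)
    (hb : ∀ y y', |b y y'| ≤ B) (ρ τ : ℝ) {n m : ℕ} (hm : 1 ≤ m)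
    (H : Fin n → Set (ScoringFunction G)) (hHm : ∀ l, PointwiseMeasurable (H l))
    (hH : ∀ l, AEMeasurable (fun S : Fin m → X × Y => empComplexity (H l) S) (sampleLaw D m))
    {δ : ℝ} (hδ : 0 < δ) (hδ1 : δ ≤ 1) :
    sampleLaw D m {S | ∃ w : Fin n → ScoringFunction G, (∀ l, w l ∈ H l) ∧
      averageComplexity D m B H +
        ENNReal.ofReal (maxLoss L * √(Real.log (1 / δ) / (2 * m))) <
      ENNReal.ofReal (deviation D L b ρ τ S (average w))} ≤ ENNReal.ofReal δ := by
  choose hmeas C hCH hCc hC using hHm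
  have hWc : {w : Fin n → ScoringFunction G | ∀ l, w l ∈ C l}.Countable := by
    simpa [Set.pi] using Set.countable_univ_pi hCc
  refine (measure_mono ?_).trans (measure_exists_deviation_countable_le D hL hM hB hb ρ τ hm H hH
    hmeas hWc (fun w hw l => hCH l (hw l)) hδ hδ1)
  rintro S ⟨w, hw, hlt⟩
  choose e heC he using fun l => hC l (w l) (hw l)
  have ht : Tendsto (fun N => deviation D L b ρ τ S (average fun l => e l N)) atTop
      (𝓝 (deviation D L b ρ τ S (average w))) := by
    refine tendsto_deviation D hL b ρ τ S
      (fun N y => measurable_ensemble (fun l y => hmeas l _ (hCH l (heC l N)) y) y) fun x y => ?_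
    exact tendsto_finsetSum _ fun l _ => (he l x y).const_mul _
  -- The bad event is a strict inequality, hence open: if the limit average violates the bound, so
  -- does some average from the countable subfamilies.
  obtain ⟨N, hN⟩ := (((ENNReal.continuous_ofReal.tendsto _).comp ht).eventually_const_lt hlt).exists
  exact ⟨fun l => e l N, fun l => heC l N, hN⟩

/-- The uniform deviation bound for averages of `n` scoring functions from `p` families. -/
lemma measure_exists_deviation_union_le (D : Measure (X × Y)) [IsProbabilityMeasure D]
    {L b : Y → Y → ℝ} (hL : IsLoss L) (hM : 0 < maxLoss L) {B : ℝ} (hB : 0 ≤ B)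
    (hb : ∀ y y', |b y y'| ≤ B) (ρ τ : ℝ) {m : ℕ} (hm : 1 ≤ m) {p : ℕ} (hp : 1 ≤ p)
    (H : Fin p → Set (ScoringFunction G)) (hHm : ∀ k, PointwiseMeasurable (H k))
    (hH : ∀ k, AEMeasurable (fun S : Fin m → X × Y => empComplexity (H k) S) (sampleLaw D m))
    {δ : ℝ} (hδ : 0 < δ) (hδ1 : δ ≤ 1) (n : ℕ) :
    sampleLaw D m {S | ∃ (κ : Fin n → Fin p) (w : Fin n → ScoringFunction G),
      (∀ l, w l ∈ H (κ l)) ∧ averageComplexity D m B (fun l => H (κ l)) +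
        ENNReal.ofReal (maxLoss L * √((n * Real.log p + Real.log (1 / δ)) / (2 * m))) <
      ENNReal.ofReal (deviation D L b ρ τ S (average w))} ≤ ENNReal.ofReal δ := by
  have hp0 : (0 : ℝ) < p := by exact_mod_cast hp
  have hpn : (0 : ℝ) < (p : ℝ) ^ n := by positivity
  -- Each of the `p ^ n` assignments of families receives the confidence `δ / p ^ n`.
  have hlog : Real.log (1 / (δ / (p : ℝ) ^ n)) = n * Real.log p + Real.log (1 / δ) := by
    rw [one_div_div, div_eq_mul_one_div, Real.log_mul hpn.ne' (by positivity), Real.log_pow]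
  have hle1 : δ / (p : ℝ) ^ n ≤ 1 := by
    rw [div_le_one hpn]
    exact hδ1.trans (one_le_pow₀ (by exact_mod_cast hp))
  have hset : {S : Fin m → X × Y | ∃ (κ : Fin n → Fin p) (w : Fin n → ScoringFunction G),
      (∀ l, w l ∈ H (κ l)) ∧ averageComplexity D m B (fun l => H (κ l)) +
        ENNReal.ofReal (maxLoss L * √((n * Real.log p + Real.log (1 / δ)) / (2 * m))) <
      ENNReal.ofReal (deviation D L b ρ τ S (average w))} =
      ⋃ κ : Fin n → Fin p, {S | ∃ w : Fin n → ScoringFunction G,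
      (∀ l, w l ∈ H (κ l)) ∧ averageComplexity D m B (fun l => H (κ l)) +
        ENNReal.ofReal (maxLoss L * √(Real.log (1 / (δ / (p : ℝ) ^ n)) / (2 * m))) <
      ENNReal.ofReal (deviation D L b ρ τ S (average w))} := by
    ext S
    simp only [hlog, Set.mem_iUnion, Set.mem_ofPred_eq]
  rw [hset]
  refine (measure_iUnion_fintype_le _ _).trans ((Finset.sum_le_sum fun κ _ =>
    measure_exists_deviation_average_le D hL hM hB hb ρ τ hm (fun l => H (κ l))
      (fun l => hHm _) (fun l => hH _) (by positivity) hle1).trans_eq ?_)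
  rw [Finset.sum_const, Finset.card_univ, Fintype.card_fun, Fintype.card_fin, Fintype.card_fin,
    nsmul_eq_mul, ← ENNReal.ofReal_natCast, ← ENNReal.ofReal_mul (by positivity)]
  congr 1
  push_cast
  field_simp

end Deviation

/-! ### Sampling from an ensemble -/

section Sampling

/-- Each marginal of the product law of `n` independent draws is the single-draw law. A general
semiring is allowed because the weights also multiply complexities in `ℝ≥0∞`. -/
lemma sum_prod_weights_mul {R : Type*} [CommSemiring R] {T n : ℕ} {a : Fin T → R}
    (ha : ∑ s, a s = 1) (r : Fin T → R) (l : Fin n) :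
    ∑ t : Fin n → Fin T, (∏ j, a (t j)) * r (t l) = ∑ s, a s * r s := by
  classical
  have h := Finset.prod_univ_sum (fun _ : Fin n => (Finset.univ : Finset (Fin T)))
    (fun j s => a s * if j = l then r s else 1)
  rw [Fintype.piFinset_univ] at h
  have h1 : ∀ t : Fin n → Fin T, ∏ j, (a (t j) * if j = l then r (t j) else 1) =
      (∏ j, a (t j)) * r (t l) := fun t => by
    rw [Finset.prod_mul_distrib]
    simp
  simp only [h1] at h
  rw [← h, Finset.prod_eq_single l]
  · simp
  · intro j _ hj
    simp [hj, ha]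
  · simp

lemma sum_prod_weights {R : Type*} [CommSemiring R] {T : ℕ} (n : ℕ) {a : Fin T → R}
    (ha : ∑ s, a s = 1) : ∑ t : Fin n → Fin T, ∏ j, a (t j) = 1 := by
  classical
  have h := Finset.prod_univ_sum (fun _ : Fin n => (Finset.univ : Finset (Fin T))) (fun _ s => a s)
  rw [Fintype.piFinset_univ] at h
  rw [← h]
  simp [ha]

/-- Hoeffding's lemma for a weighted average of finitely many numbers in `[-1, 1]`. -/
lemma sum_mul_exp_le {T : ℕ} {α u : Fin T → ℝ} (hα : ∀ s, 0 ≤ α s) (hα1 : ∑ s, α s = 1)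
    (hu : ∀ s, |u s| ≤ 1) (t : ℝ) :
    ∑ s, α s * Real.exp (t * u s) ≤ Real.exp (t * ∑ s, α s * u s + t ^ 2 / 2) := by
  set D : Measure (Fin T) := ∑ s, ENNReal.ofReal (α s) • Measure.dirac s with hD
  have hint : ∀ f : Fin T → ℝ, ∫ s, f s ∂D = ∑ s, α s * f s := fun f => by
    rw [hD, integral_finsetSum_measure fun s _ =>
      (Integrable.of_finite (μ := Measure.dirac s)).smul_measure ENNReal.ofReal_ne_top]
    refine Finset.sum_congr rfl fun s _ => ?_
    rw [integral_smul_measure, integral_dirac, ENNReal.toReal_ofReal (hα s), smul_eq_mul]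
  have : IsProbabilityMeasure D := ⟨by
    rw [hD]
    simp only [Measure.coe_finsetSum, Finset.sum_apply, Measure.smul_apply, measure_univ,
      smul_eq_mul, mul_one]
    rw [← ENNReal.ofReal_sum_of_nonneg fun s _ => hα s, hα1, ENNReal.ofReal_one]⟩
  have h := integral_exp_le_of_oscillation D (X := u) (measurable_of_finite _) (c := 2)
    (fun s s' => by linarith [(abs_le.1 (hu s)).2, (abs_le.1 (hu s')).1]) t
  rw [hint, hint] at h
  refine h.trans_eq ?_
  ring_nf

/-- Hoeffding's inequality for the average of `n` independent draws from a finite set of numbers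
in `[-1, 1]` with weights `α`. -/
lemma sum_prod_weights_ite_le {T n : ℕ} (hn : 1 ≤ n) {α u : Fin T → ℝ} (hα : ∀ s, 0 ≤ α s)
    (hα1 : ∑ s, α s = 1) (hu : ∀ s, |u s| ≤ 1) {ρ : ℝ} (hρ : 0 < ρ) :
    ∑ t : Fin n → Fin T, (∏ j, α (t j)) *
      (if ρ / 2 < (n : ℝ)⁻¹ * ∑ j, u (t j) - ∑ s, α s * u s then 1 else 0) ≤
      Real.exp (-(n * ρ ^ 2 / 8)) := by
  set a := ∑ s, α s * u s with ha
  have hn0 : (0 : ℝ) < n := by exact_mod_cast hn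
  -- Chernoff's bound with exponent `ρ / 2`, the minimizer of `n s² / 2 - n s ρ / 2` over `s`.
  have hpt : ∀ t : Fin n → Fin T,
      (if ρ / 2 < (n : ℝ)⁻¹ * ∑ j, u (t j) - a then (1 : ℝ) else 0) ≤
        Real.exp (-(ρ / 2 * (n * a + n * (ρ / 2)))) * ∏ j, Real.exp (ρ / 2 * u (t j)) := by
    intro t
    split_ifs with h
    · rw [← Real.exp_sum, ← Real.exp_add, ← Finset.mul_sum]
      refine Real.one_le_exp ?_
      have h1 : n * (ρ / 2) + n * a < ∑ j, u (t j) := by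
        have h2 := mul_lt_mul_of_pos_left h hn0
        rw [mul_sub, mul_inv_cancel_left₀ hn0.ne'] at h2
        linarith
      nlinarith
    · exact mul_nonneg (Real.exp_pos _).le (Finset.prod_nonneg fun _ _ => (Real.exp_pos _).le)
  have hfact : ∑ t : Fin n → Fin T, (∏ j, α (t j)) * ∏ j, Real.exp (ρ / 2 * u (t j)) =
      (∑ s, α s * Real.exp (ρ / 2 * u s)) ^ n := by
    classical
    have h := Finset.prod_univ_sum (fun _ : Fin n => (Finset.univ : Finset (Fin T)))
      (fun _ s => α s * Real.exp (ρ / 2 * u s))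
    rw [Fintype.piFinset_univ] at h
    simp only [Finset.prod_mul_distrib] at h
    rw [← h]
    simp
  calc _ ≤ ∑ t : Fin n → Fin T, (∏ j, α (t j)) *
        (Real.exp (-(ρ / 2 * (n * a + n * (ρ / 2)))) * ∏ j, Real.exp (ρ / 2 * u (t j))) :=
        Finset.sum_le_sum fun t _ =>
          mul_le_mul_of_nonneg_left (hpt t) (Finset.prod_nonneg fun j _ => hα _)
    _ = Real.exp (-(ρ / 2 * (n * a + n * (ρ / 2)))) *
        (∑ s, α s * Real.exp (ρ / 2 * u s)) ^ n := by
        rw [← hfact, Finset.mul_sum (Finset.univ : Finset (Fin n → Fin T))]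
        exact Finset.sum_congr rfl fun t _ => by ring
    _ ≤ Real.exp (-(ρ / 2 * (n * a + n * (ρ / 2)))) *
        Real.exp (ρ / 2 * a + (ρ / 2) ^ 2 / 2) ^ n := by
        refine mul_le_mul_of_nonneg_left (pow_le_pow_left₀ ?_ ?_ n) (Real.exp_pos _).le
        · exact Finset.sum_nonneg fun s _ => mul_nonneg (hα s) (Real.exp_pos _).le
        · exact sum_mul_exp_le hα hα1 hu _
    _ = _ := by
        rw [← Real.exp_nat_mul, ← Real.exp_add]
        congr 1
        ring

end Sampling

section Ensemble

variable {X : Type u} {Y : Type v} {G : X × Y → OutputGraph Y}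

lemma ensemble_sub {T : ℕ} (α : Fin T → ℝ) (h : Fin T → ScoringFunction G) (x : X) (y y' : Y) :
    ensemble α h x y - ensemble α h x y' = ∑ t, α t * ((h t).score x y - (h t).score x y') := by
  simp only [ensemble, mul_sub, Finset.sum_sub_distrib]

lemma average_sub {n : ℕ} (w : Fin n → ScoringFunction G) (x : X) (y y' : Y) :
    average w x y - average w x y' =
      (n : ℝ)⁻¹ * ∑ j, ((w j).score x y - (w j).score x y') := by
  rw [ensemble_sub, Finset.mul_sum]

/-- By linearity, the mean complexity over the random draw does not depend on `n`: every drawn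
member has law `α`. -/
lemma sum_weights_averageComplexity [MeasurableSpace X] [MeasurableSpace Y]
    (D : Measure (X × Y)) (m : ℕ) (B : ℝ) {T n p : ℕ}
    (hn : 1 ≤ n) (H : Fin p → Set (ScoringFunction G)) {α : Fin T → ℝ} (hα : ∀ s, 0 ≤ α s)
    (hα1 : ∑ s, α s = 1) (k : Fin T → Fin p) :
    ∑ t : Fin n → Fin T, (∏ j, ENNReal.ofReal (α (t j))) *
        averageComplexity D m B (fun j => H (k (t j))) =
      ENNReal.ofReal (4 * √2 * B) * ∑ s, ENNReal.ofReal (α s) * complexity D m (H (k s)) := by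
  have hα1' : ∑ s, ENNReal.ofReal (α s) = 1 := by
    rw [← ENNReal.ofReal_sum_of_nonneg fun s _ => hα s, hα1, ENNReal.ofReal_one]
  have hn0 : (0 : ℝ) < n := by exact_mod_cast hn
  calc _ = ENNReal.ofReal (4 * √2 * B) * (ENNReal.ofReal (n : ℝ)⁻¹ * ∑ l : Fin n,
        ∑ t : Fin n → Fin T, (∏ j, ENNReal.ofReal (α (t j))) *
          complexity D m (H (k (t l)))) := by
        rw [Finset.sum_comm, Finset.mul_sum, Finset.mul_sum]
        refine Finset.sum_congr rfl fun t _ => ?_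
        rw [averageComplexity, ← Finset.mul_sum]
        ring
    _ = _ := by
        simp only [sum_prod_weights_mul hα1' fun s => complexity D m (H (k s))]
        rw [Finset.sum_const, Finset.card_univ, Fintype.card_fin, nsmul_eq_mul, ← mul_assoc
          (ENNReal.ofReal (n : ℝ)⁻¹), ← ENNReal.ofReal_natCast,
          ← ENNReal.ofReal_mul (by positivity), inv_mul_cancel₀ hn0.ne', ENNReal.ofReal_one,
          one_mul]

variable [Fintype Y]

/-- The loss of a predictor for an ensemble is at most the mean margin loss of a random average of
its members. -/
lemma loss_le_sum_marginLoss {L b : Y → Y → ℝ} (hL : IsLoss L) (hb : ∀ y y', 0 ≤ b y y')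
    {ρ : ℝ} (hρ : 0 < ρ) {T n : ℕ} (hn : 1 ≤ n) {α : Fin T → ℝ} (hα : ∀ s, 0 ≤ α s)
    (hα1 : ∑ s, α s = 1) {h : Fin T → ScoringFunction G}
    (hh : ∀ s x y y', |(h s).score x y - (h s).score x y'| ≤ 1) (z : X × Y) {y₀ : Y}
    (hy₀ : ∀ y, ensemble α h z.1 y ≤ ensemble α h z.1 y₀) :
    L y₀ z.2 ≤ ∑ t : Fin n → Fin T, (∏ j, α (t j)) *
      marginLoss L b ρ (1 / 2) (average fun j => h (t j)) z +
        maxLoss L * Real.exp (-(n * ρ ^ 2 / 8)) := by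
  classical
  have hM := maxLoss_nonneg hL
  set u : Fin T → ℝ := fun s => (h s).score z.1 z.2 - (h s).score z.1 y₀ with hu
  have hH := sum_prod_weights_ite_le hn hα hα1 (u := u) (fun s => hh s _ _ _) hρ
  have hneg : ∑ s, α s * u s ≤ 0 := by
    rw [← ensemble_sub]
    linarith [hy₀ z.2]
  have hpt : ∀ t : Fin n → Fin T, L y₀ z.2 ≤
      marginLoss L b ρ (1 / 2) (average fun j => h (t j)) z + maxLoss L *
        (if ρ / 2 < (n : ℝ)⁻¹ * ∑ j, u (t j) - ∑ s, α s * u s then 1 else 0) := by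
    intro t
    have h0 := (marginLoss_mem_Icc hL b ρ (1 / 2) (average fun j => h (t j)) z).1
    split_ifs with hlt
    · linarith [le_maxLoss L y₀ z.2]
    -- The ensemble margin against the predicted label is at most 0, so here the margin of the
    -- average is at most `ρ / 2` and the `τ = 1/2` loss dominates `L`.
    · rw [mul_zero, add_zero]
      by_cases hy : y₀ = z.2
      · rwa [(hL.definite _ _).2 hy]
      · have h1 : clip (maxLoss L) (L y₀ z.2) = L y₀ z.2 := by
          rw [clip, max_eq_right (hL.nonneg _ _), min_eq_right (le_maxLoss L _ _)]
        rw [← h1]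
        refine clip_mono _ ?_
        refine le_trans ?_ (le_iSup_of_finite (fun y' : {y' // y' ≠ z.2} =>
          L y' z.2 + b y' z.2 * (1 / 2 * ρ - (average (fun j => h (t j)) z.1 z.2 -
            average (fun j => h (t j)) z.1 y'))) ⟨y₀, hy⟩)
        simp only [average_sub]
        have h2 : 0 ≤ 1 / 2 * ρ - (n : ℝ)⁻¹ * ∑ j, u (t j) := by linarith
        linarith [mul_nonneg (hb y₀ z.2) h2]
  have hW : ∀ t : Fin n → Fin T, 0 ≤ ∏ j, α (t j) := fun t => Finset.prod_nonneg fun j _ => hα _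
  calc L y₀ z.2 = ∑ t : Fin n → Fin T, (∏ j, α (t j)) * L y₀ z.2 := by
        rw [← Finset.sum_mul, sum_prod_weights n hα1, one_mul]
    _ ≤ ∑ t : Fin n → Fin T, (∏ j, α (t j)) *
        (marginLoss L b ρ (1 / 2) (average fun j => h (t j)) z + maxLoss L *
        (if ρ / 2 < (n : ℝ)⁻¹ * ∑ j, u (t j) - ∑ s, α s * u s then 1 else 0)) :=
        Finset.sum_le_sum fun t _ => mul_le_mul_of_nonneg_left (hpt t) (hW t)
    _ = ∑ t : Fin n → Fin T, (∏ j, α (t j)) *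
          marginLoss L b ρ (1 / 2) (average fun j => h (t j)) z +
        maxLoss L * ∑ t : Fin n → Fin T, (∏ j, α (t j)) *
        (if ρ / 2 < (n : ℝ)⁻¹ * ∑ j, u (t j) - ∑ s, α s * u s then 1 else 0) := by
        rw [Finset.mul_sum, ← Finset.sum_add_distrib]
        exact Finset.sum_congr rfl fun t _ => by ring
    _ ≤ _ := by gcongr

/-- The mean margin loss of a random average of members of an ensemble is controlled by the margin
loss of the ensemble with a larger margin parameter. -/
lemma sum_marginLoss_le {L b : Y → Y → ℝ} (hL : IsLoss L) (hb : ∀ y y', 0 ≤ b y y')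
    {ρ : ℝ} (hρ : 0 < ρ) {T n : ℕ} (hn : 1 ≤ n) {α : Fin T → ℝ} (hα : ∀ s, 0 ≤ α s)
    (hα1 : ∑ s, α s = 1) {h : Fin T → ScoringFunction G}
    (hh : ∀ s x y y', |(h s).score x y - (h s).score x y'| ≤ 1) (z : X × Y) :
    ∑ t : Fin n → Fin T, (∏ j, α (t j)) *
      marginLoss L b ρ (1 / 2) (average fun j => h (t j)) z ≤
      marginLoss L b ρ 1 (ensemble α h) z +
        maxLoss L * ((Fintype.card Y - 1) * Real.exp (-(n * ρ ^ 2 / 8))) := by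
  classical
  have hM := maxLoss_nonneg hL
  set u : Y → Fin T → ℝ := fun y' s => (h s).score z.1 y' - (h s).score z.1 z.2 with hu
  have hH := fun y' => sum_prod_weights_ite_le hn hα hα1 (u := u y') (fun s => hh s _ _ _) hρ
  have hpt : ∀ t : Fin n → Fin T,
      marginLoss L b ρ (1 / 2) (average fun j => h (t j)) z ≤
      marginLoss L b ρ 1 (ensemble α h) z + maxLoss L * ∑ y' ∈ Finset.univ.erase z.2,
        (if ρ / 2 < (n : ℝ)⁻¹ * ∑ j, u y' (t j) - ∑ s, α s * u y' s then 1 else 0) := by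
    intro t
    have h0 := (marginLoss_mem_Icc hL b ρ 1 (ensemble α h) z).1
    have h0' := (marginLoss_mem_Icc hL b ρ (1 / 2) (average fun j => h (t j)) z).2
    -- Either some wrong label gains more than `ρ / 2`, and the sum of indicators pays the full
    -- maximal loss, or every margin drops by at most `ρ / 2`, which the passage from `τ = 1/2` to
    -- `τ = 1` absorbs.
    by_cases hex : ∃ y', y' ≠ z.2 ∧ ρ / 2 < (n : ℝ)⁻¹ * ∑ j, u y' (t j) - ∑ s, α s * u y' s
    · obtain ⟨y', hy', hlt⟩ := hex
      have h1 : (1 : ℝ) ≤ ∑ y' ∈ Finset.univ.erase z.2,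
          (if ρ / 2 < (n : ℝ)⁻¹ * ∑ j, u y' (t j) - ∑ s, α s * u y' s then 1 else 0) := by
        refine le_trans (le_of_eq ?_) (Finset.single_le_sum (fun y _ => ?_)
          (Finset.mem_erase.2 ⟨hy', Finset.mem_univ _⟩))
        · rw [if_pos hlt]
        · split_ifs <;> norm_num
      have h2 := mul_le_mul_of_nonneg_left h1 hM
      linarith
    · push Not at hex
      have h1 : 0 ≤ ∑ y' ∈ Finset.univ.erase z.2,
          (if ρ / 2 < (n : ℝ)⁻¹ * ∑ j, u y' (t j) - ∑ s, α s * u y' s then (1 : ℝ) else 0) :=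
        Finset.sum_nonneg fun y _ => by split_ifs <;> norm_num
      have h2 := mul_nonneg hM h1
      refine le_trans ?_ (le_add_of_nonneg_right h2)
      refine clip_mono _ (ciSup_mono (Set.finite_range _).bddAbove fun y' => ?_)
      have h3 := hex y' y'.2
      have h4 : (n : ℝ)⁻¹ * ∑ j, u y' (t j) = -(average (fun j => h (t j)) z.1 z.2 -
          average (fun j => h (t j)) z.1 y') := by rw [neg_sub, average_sub]
      have h5 : ∑ s, α s * u y' s = -(ensemble α h z.1 z.2 - ensemble α h z.1 y') := by
        rw [neg_sub, ensemble_sub]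
      rw [h4, h5] at h3
      refine add_le_add_right (mul_le_mul_of_nonneg_left ?_ (hb _ _)) _
      linarith
  have hW : ∀ t : Fin n → Fin T, 0 ≤ ∏ j, α (t j) := fun t => Finset.prod_nonneg fun j _ => hα _
  calc _ ≤ ∑ t : Fin n → Fin T, (∏ j, α (t j)) *
        (marginLoss L b ρ 1 (ensemble α h) z + maxLoss L * ∑ y' ∈ Finset.univ.erase z.2,
        (if ρ / 2 < (n : ℝ)⁻¹ * ∑ j, u y' (t j) - ∑ s, α s * u y' s then 1 else 0)) :=
        Finset.sum_le_sum fun t _ => mul_le_mul_of_nonneg_left (hpt t) (hW t)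
    _ = marginLoss L b ρ 1 (ensemble α h) z + maxLoss L * ∑ y' ∈ Finset.univ.erase z.2,
        ∑ t : Fin n → Fin T, (∏ j, α (t j)) *
        (if ρ / 2 < (n : ℝ)⁻¹ * ∑ j, u y' (t j) - ∑ s, α s * u y' s then 1 else 0) := by
        rw [Finset.sum_comm]
        simp only [mul_add, Finset.sum_add_distrib, ← Finset.sum_mul, ← Finset.mul_sum]
        rw [sum_prod_weights n hα1, one_mul]
        congr 1
        rw [Finset.mul_sum]
        exact Finset.sum_congr rfl fun t _ => by ring
    _ ≤ marginLoss L b ρ 1 (ensemble α h) z + maxLoss L * ∑ y' ∈ Finset.univ.erase z.2,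
        Real.exp (-(n * ρ ^ 2 / 8)) := by
        gcongr with y'
        exact hH y'
    _ = _ := by
        rw [Finset.sum_const, Finset.card_erase_of_mem (Finset.mem_univ _), Finset.card_univ,
          nsmul_eq_mul, Nat.cast_sub (Fintype.card_pos_iff.2 ⟨z.2⟩), Nat.cast_one]

variable [MeasurableSpace X] [MeasurableSpace Y] [MeasurableSingletonClass Y]

/-- One Hoeffding error from the risk and `c - 1` from the empirical loss add up to the factor `c`.
-/
lemma risk_sub_le (D : Measure (X × Y)) [IsProbabilityMeasure D] {L b : Y → Y → ℝ}
    (hL : IsLoss L) (hb : ∀ y y', 0 ≤ b y y') {ρ : ℝ} (hρ : 0 < ρ) {T n m : ℕ} (hm : 1 ≤ m)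
    (hn : 1 ≤ n) {α : Fin T → ℝ} (hα : ∀ s, 0 ≤ α s) (hα1 : ∑ s, α s = 1)
    {h : Fin T → ScoringFunction G} (hmeas : ∀ s y, Measurable fun x => (h s).score x y)
    (hh : ∀ s x y y', |(h s).score x y - (h s).score x y'| ≤ 1) {g : X → Y}
    (hg : IsPredictor (ensemble α h) g) (S : Fin m → X × Y) :
    risk D L g - (m : ℝ)⁻¹ * ∑ i, marginLoss L b ρ 1 (ensemble α h) (S i) ≤
      ∑ t : Fin n → Fin T, (∏ j, α (t j)) *
        deviation D L b ρ (1 / 2) S (average fun j => h (t j)) +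
      maxLoss L * (Fintype.card Y * Real.exp (-(n * ρ ^ 2 / 8))) := by
  have hm0 : (0 : ℝ) < m := by exact_mod_cast hm
  have hint : ∀ t : Fin n → Fin T,
      Integrable (marginLoss L b ρ (1 / 2) (average fun j => h (t j))) D := fun t =>
    integrable_of_abs_le (C := maxLoss L) (measurable_marginLoss L b ρ _
      (measurable_ensemble fun j y => hmeas (t j) y)) fun z => by
        have := marginLoss_mem_Icc hL b ρ (1 / 2) (average fun j => h (t j)) z
        rw [abs_of_nonneg this.1]
        exact this.2
  have hrisk : risk D L g ≤ ∑ t : Fin n → Fin T, (∏ j, α (t j)) *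
      ∫ z, marginLoss L b ρ (1 / 2) (average fun j => h (t j)) z ∂D +
        maxLoss L * Real.exp (-(n * ρ ^ 2 / 8)) := by
    have hsum : Integrable (fun z => ∑ t : Fin n → Fin T, (∏ j, α (t j)) *
        marginLoss L b ρ (1 / 2) (average fun j => h (t j)) z) D :=
      integrable_finsetSum _ fun t _ => (hint t).const_mul _
    calc risk D L g ≤ ∫ z, (∑ t : Fin n → Fin T, (∏ j, α (t j)) *
          marginLoss L b ρ (1 / 2) (average fun j => h (t j)) z +
            maxLoss L * Real.exp (-(n * ρ ^ 2 / 8))) ∂D :=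
          integral_mono_of_nonneg (ae_of_all _ fun z => hL.nonneg _ _)
            (hsum.add (integrable_const _)) (ae_of_all _ fun z =>
              loss_le_sum_marginLoss hL hb hρ hn hα hα1 hh z (hg.2 z.1))
      _ = _ := by
          rw [integral_add hsum (integrable_const _),
            integral_finsetSum _ fun t _ => (hint t).const_mul _]
          simp [integral_const_mul]
  have hemp : (m : ℝ)⁻¹ * ∑ i, ∑ t : Fin n → Fin T, (∏ j, α (t j)) *
      marginLoss L b ρ (1 / 2) (average fun j => h (t j)) (S i) ≤
      (m : ℝ)⁻¹ * ∑ i, (marginLoss L b ρ 1 (ensemble α h) (S i) +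
        maxLoss L * ((Fintype.card Y - 1) * Real.exp (-(n * ρ ^ 2 / 8)))) := by
    gcongr with i
    exact sum_marginLoss_le hL hb hρ hn hα hα1 hh (S i)
  rw [Finset.sum_add_distrib, mul_add, Finset.sum_const, Finset.card_univ, Fintype.card_fin,
    nsmul_eq_mul, inv_mul_cancel_left₀ hm0.ne'] at hemp
  have hdev : ∑ t : Fin n → Fin T, (∏ j, α (t j)) *
        deviation D L b ρ (1 / 2) S (average fun j => h (t j)) =
      ∑ t : Fin n → Fin T, (∏ j, α (t j)) *
        ∫ z, marginLoss L b ρ (1 / 2) (average fun j => h (t j)) z ∂D -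
      (m : ℝ)⁻¹ * ∑ i, ∑ t : Fin n → Fin T, (∏ j, α (t j)) *
        marginLoss L b ρ (1 / 2) (average fun j => h (t j)) (S i) := by
    simp only [deviation, mul_sub, Finset.sum_sub_distrib]
    congr 1
    rw [Finset.sum_comm, Finset.mul_sum]
    refine Finset.sum_congr rfl fun t _ => ?_
    rw [← Finset.mul_sum]
    ring
  rw [hdev]
  linarith

/-- On a sample where the averages of `n` scoring functions have small deviation, the risk of every
ensemble is controlled by its empirical margin loss. -/
lemma ofReal_risk_sub_le (D : Measure (X × Y)) [IsProbabilityMeasure D] {L b : Y → Y → ℝ}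
    (hL : IsLoss L) (hb : ∀ y y', 0 ≤ b y y') (B : ℝ) {ρ : ℝ} (hρ : 0 < ρ) {T n m p : ℕ}
    (hm : 1 ≤ m) (hn : 1 ≤ n) {H : Fin p → Set (ScoringFunction G)}
    (hHm : ∀ k, PointwiseMeasurable (H k))
    (hH : ∀ k, ∀ h ∈ H k, ∀ x y y', |h.score x y - h.score x y'| ≤ 1)
    {α : Fin T → ℝ} (hα : ∀ s, 0 ≤ α s) (hα1 : ∑ s, α s = 1) {k : Fin T → Fin p}
    {h : Fin T → ScoringFunction G} (hh : ∀ s, h s ∈ H (k s)) {g : X → Y}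
    (hg : IsPredictor (ensemble α h) g) {S : Fin m → X × Y} {Q : ℝ} (hQ : 0 ≤ Q)
    (hS : ∀ (κ : Fin n → Fin p) (w : Fin n → ScoringFunction G), (∀ l, w l ∈ H (κ l)) →
      ENNReal.ofReal (deviation D L b ρ (1 / 2) S (average w)) ≤
        averageComplexity D m B (fun l => H (κ l)) + ENNReal.ofReal Q) :
    ENNReal.ofReal
        (risk D L g - (m : ℝ)⁻¹ * ∑ i, marginLoss L b ρ 1 (ensemble α h) (S i)) ≤
      ENNReal.ofReal (4 * √2 * B) * ∑ s, ENNReal.ofReal (α s) * complexity D m (H (k s)) +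
        ENNReal.ofReal (Q + maxLoss L * (Fintype.card Y * Real.exp (-(n * ρ ^ 2 / 8)))) := by
  have hα1' : ∑ s, ENNReal.ofReal (α s) = 1 := by
    rw [← ENNReal.ofReal_sum_of_nonneg fun s _ => hα s, hα1, ENNReal.ofReal_one]
  have hM := maxLoss_nonneg hL
  refine (ENNReal.ofReal_le_ofReal (risk_sub_le D hL hb hρ hm hn hα hα1
    (fun s y => (hHm (k s)).1 _ (hh s) y) (fun s => hH _ _ (hh s)) hg S)).trans ?_
  refine ENNReal.ofReal_add_le.trans ?_
  rw [ENNReal.ofReal_add hQ (by positivity), ← add_assoc]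
  refine add_le_add_left ?_ _
  calc ENNReal.ofReal (∑ t : Fin n → Fin T, (∏ j, α (t j)) *
        deviation D L b ρ (1 / 2) S (average fun j => h (t j)))
      ≤ ∑ t : Fin n → Fin T, ENNReal.ofReal ((∏ j, α (t j)) *
        deviation D L b ρ (1 / 2) S (average fun j => h (t j))) :=
        Finset.le_sum_of_subadditive _ ENNReal.ofReal_zero.le (fun _ _ => ENNReal.ofReal_add_le) _ _
    _ ≤ ∑ t : Fin n → Fin T, (∏ j, ENNReal.ofReal (α (t j))) *
        (averageComplexity D m B (fun j => H (k (t j))) + ENNReal.ofReal Q) := by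
        refine Finset.sum_le_sum fun t _ => ?_
        rw [ENNReal.ofReal_mul (Finset.prod_nonneg fun j _ => hα _),
          ENNReal.ofReal_prod_of_nonneg fun j _ => hα _]
        gcongr
        exact hS (fun j => k (t j)) (fun j => h (t j)) fun j => hh _
    _ = _ := by
        simp only [mul_add, Finset.sum_add_distrib]
        rw [sum_weights_averageComplexity D m B hn H hα hα1 k, ← Finset.sum_mul,
          sum_prod_weights n hα1', one_mul]

end Ensemble

/-! ### The voted risk minimization bound -/

section Slack

lemma sqrt_mul_div_le {M : ℝ} (hM : 0 < M) (δ : ℝ) {m : ℕ} (hm : 1 ≤ m)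
    {n p : ℕ} {N : ℝ} (hN : (n : ℝ) = N) :
    M * √((n * Real.log p + Real.log (1 / (δ / 2))) / (2 * m)) ≤
      M * √(N * (Real.log p / m) + Real.log (2 / δ) / (2 * m)) := by
  have hm0 : (0 : ℝ) < m := by exact_mod_cast hm
  have hl : 0 ≤ Real.log p := Real.log_natCast_nonneg p
  gcongr
  rw [one_div_div, ← hN, add_div]
  gcongr
  rw [mul_div_assoc]
  gcongr
  linarith

/-- Unless the slack exceeds the maximal loss, some number `n` of draws from an ensemble makes the
sum of the approximation error and the union bound term at most the slack. -/
lemma exists_le_slack {ρ M δ : ℝ} (hρ : 0 < ρ) (hM : 0 < M) (hδ : 0 < δ) (hδ1 : δ < 1)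
    {c m p : ℕ} (hc : 1 ≤ c) (hm : 1 ≤ m) (hp : 1 ≤ p) :
    M ≤ slack ρ M δ c m p ∨ ∃ n : ℕ, 1 ≤ n ∧
      M * √((n * Real.log p + Real.log (1 / (δ / 2))) / (2 * m)) +
        M * (c * Real.exp (-(n * ρ ^ 2 / 8))) ≤ slack ρ M δ c m p := by
  have hm0 : (0 : ℝ) < m := by exact_mod_cast hm
  have hc0 : (1 : ℝ) ≤ c := by exact_mod_cast hc
  have hlog2 : 0 < Real.log (2 / δ) := Real.log_pos (by rw [lt_div_iff₀ hδ]; linarith)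
  rcases hp.eq_or_lt with rfl | hp2
  -- For a single family the union term does not depend on `n`, so `n` is taken large enough for the
  -- approximation error to fit into the spare multiples of the square root.
  · right
    set x := Real.log (2 / δ) / (2 * m) with hx
    have hx0 : 0 < √x := Real.sqrt_pos.2 (by positivity)
    have ht : Tendsto (fun n : ℕ => (c : ℝ) * Real.exp (-(n * ρ ^ 2 / 8))) atTop (𝓝 0) := by
      have h1 : Tendsto (fun n : ℕ => (n : ℝ) * (ρ ^ 2 / 8)) atTop atTop :=
        tendsto_natCast_atTop_atTop.atTop_mul_const (by positivity)
      simpa [mul_div_assoc] using (Real.tendsto_exp_neg_atTop_nhds_zero.comp h1).const_mul (c : ℝ)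
    obtain ⟨n, hn, hn1⟩ := ((ht.eventually_le_const hx0).and (eventually_ge_atTop 1)).exists
    refine ⟨n, hn1, ?_⟩
    have h1 := mul_le_mul_of_nonneg_left hn hM.le
    have h2 : 0 < M * √x := by positivity
    simp only [slack, Nat.cast_one, Real.log_one, mul_zero, zero_div, zero_add, Real.sqrt_zero,
      one_div_div, ← hx]
    linarith
  · have hl : 0 < Real.log p := Real.log_pos (by exact_mod_cast hp2)
    set A := (c : ℝ) ^ 2 * ρ ^ 2 * m / (4 * Real.log p) with hA
    have hA0 : 0 < A := by positivity
    have hAeq : Real.log p / m = (c * ρ / 2) ^ 2 / A := by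
      rw [hA]
      field_simp
      ring
    have hsqrt : √(Real.log p / m) = c * ρ / 2 / √A := by
      rw [hAeq, Real.sqrt_div (sq_nonneg _), Real.sqrt_sq (by positivity)]
    have hsA : 0 < √A := Real.sqrt_pos.2 hA0
    -- The first term of the slack is exactly the approximation error that results when `exp (-n ρ²
    -- / 8) = 1 / √A`, that is, when `n = 4 / ρ² * log A`; the ceiling `N` rounds this up.
    have hfirst : 2 * M / ρ * √(Real.log p / m) = M * (c / √A) := by
      rw [hsqrt]
      field_simp
    set N : ℤ := ⌈4 / ρ ^ 2 * Real.log A⌉ with hN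
    have hNle : 4 / ρ ^ 2 * Real.log A ≤ N := Int.le_ceil _
    have hlogA : Real.log A ≤ N * ρ ^ 2 / 4 := by
      rw [div_mul_eq_mul_div, div_le_iff₀ (by positivity)] at hNle
      linarith
    rcases le_or_gt N 0 with hN0 | hN0
    -- A nonpositive ceiling means `A ≤ 1`, and then the first term of the slack alone exceeds or
    -- equals `M`.
    · left
      have hN0' : (N : ℝ) ≤ 0 := by exact_mod_cast hN0
      have h1 : Real.log A ≤ 0 := hlogA.trans (by nlinarith [sq_nonneg ρ])
      have h2 : A ≤ 1 := by rwa [Real.log_nonpos_iff hA0.le] at h1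
      have h3 : √A ≤ 1 := Real.sqrt_le_one.2 h2
      have h4 : 1 ≤ c / √A := by
        rw [le_div_iff₀ hsA]
        linarith
      have h5 := mul_le_mul_of_nonneg_left h4 hM.le
      rw [slack, hfirst]
      have h6 : 0 ≤ 3 * M * √(N * (Real.log p / m) + Real.log (2 / δ) / (2 * m)) := by positivity
      linarith
    · right
      obtain ⟨n, hn⟩ := Int.eq_ofNat_of_zero_le hN0.le
      have hnN : (n : ℝ) = N := by rw [hn]; simp
      refine ⟨n, by omega, ?_⟩
      have h1 := sqrt_mul_div_le hM δ hm (p := p) hnN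
      have h2 : Real.exp (-(n * ρ ^ 2 / 8)) ≤ 1 / √A := by
        have h3 : √A = Real.exp (Real.log A / 2) := by
          rw [Real.exp_half, Real.exp_log hA0]
        rw [h3, one_div, ← Real.exp_neg, hnN]
        exact Real.exp_le_exp.2 (by linarith)
      have h4 : M * (c * Real.exp (-(n * ρ ^ 2 / 8))) ≤ M * (c / √A) := by
        rw [div_eq_mul_one_div (c : ℝ)]
        gcongr
      have h5 : 0 ≤ M * √(N * (Real.log p / m) + Real.log (2 / δ) / (2 * m)) := by positivity
      rw [slack, hfirst]
      linarith

end Slack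

lemma risk_le_maxLoss {X : Type u} {Y : Type v} [MeasurableSpace X] [MeasurableSpace Y]
    [Fintype Y] (D : Measure (X × Y)) [IsProbabilityMeasure D] {L : Y → Y → ℝ} (hL : IsLoss L)
    (g : X → Y) : risk D L g ≤ maxLoss L := by
  refine (le_abs_self _).trans (abs_integral_le_of_abs_le fun z => ?_)
  rw [abs_of_nonneg (hL.nonneg _ _)]
  exact le_maxLoss L _ _

lemma average_marginLoss_nonneg {X : Type u} {Y : Type v} {L : Y → Y → ℝ} (hL : IsLoss L)
    (b : Y → Y → ℝ) (ρ τ : ℝ) (s : X → Y → ℝ) {m : ℕ} (S : Fin m → X × Y) :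
    0 ≤ (m : ℝ)⁻¹ * ∑ i, marginLoss L b ρ τ s (S i) :=
  mul_nonneg (by positivity) (Finset.sum_nonneg fun i _ => (marginLoss_mem_Icc hL b ρ τ s _).1)

/-- The voted risk minimization bound for margin losses with weights `b`. -/
lemma measure_not_risk_sub_le {X : Type u} {Y : Type v} [MeasurableSpace X] [MeasurableSpace Y]
    [Fintype Y] [MeasurableSingletonClass Y] (D : Measure (X × Y)) [IsProbabilityMeasure D]
    {L b : Y → Y → ℝ} (hL : IsLoss L) {B : ℝ} (hb : ∀ y y', 0 ≤ b y y') (hbB : ∀ y y', b y y' ≤ B)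
    {G : X × Y → OutputGraph Y} {m : ℕ} (hm : 1 ≤ m) {p : ℕ} (H : Fin p → Set (ScoringFunction G))
    (hHm : ∀ k, PointwiseMeasurable (H k))
    (hHe : ∀ k, AEMeasurable (fun S : Fin m → X × Y => empComplexity (H k) S) (sampleLaw D m))
    (hH : ∀ k, ∀ h ∈ H k, ∀ x y y', |h.score x y - h.score x y'| ≤ 1)
    {ρ : ℝ} (hρ : 0 < ρ) {δ : ℝ} (hδ : 0 < δ) (hδ1 : δ < 1) :
    sampleLaw D m {S | ¬ ∀ (T : ℕ) (α : Fin T → ℝ) (k : Fin T → Fin p)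
        (h : Fin T → ScoringFunction G) (g : X → Y),
        (∀ t, 0 ≤ α t) → ∑ t, α t = 1 → (∀ t, h t ∈ H (k t)) → IsPredictor (ensemble α h) g →
        ENNReal.ofReal
            (risk D L g - (m : ℝ)⁻¹ * ∑ i, marginLoss L b ρ 1 (ensemble α h) (S i)) ≤
          ENNReal.ofReal (4 * √2 * B) * ∑ t, ENNReal.ofReal (α t) * complexity D m (H (k t)) +
            ENNReal.ofReal (slack ρ (maxLoss L) δ (Fintype.card Y) m p)} ≤
      ENNReal.ofReal (δ / 2) := by
  obtain ⟨z₀⟩ := nonempty_of_isProbabilityMeasure D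
  have hM0 := maxLoss_nonneg hL
  have hs0 : 0 ≤ slack ρ (maxLoss L) δ (Fintype.card Y) m p := by
    rw [slack]
    positivity
  have hB : 0 ≤ B := (hb z₀.2 z₀.2).trans (hbB _ _)
  -- Weights summing to 1 need at least one member, so without families the bad event is empty.
  have hp_of : ∀ {T : ℕ} {α : Fin T → ℝ}, ∑ t, α t = 1 → ∀ _ : Fin T → Fin p, 1 ≤ p := by
    intro T α hα k
    rcases Nat.eq_zero_or_pos T with rfl | hT
    · simp at hα
    · exact Nat.one_le_iff_ne_zero.2 fun h0 => by
        subst h0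
        exact (k ⟨0, hT⟩).elim0
  have htriv : maxLoss L ≤ slack ρ (maxLoss L) δ (Fintype.card Y) m p →
      ∀ (S : Fin m → X × Y) (f : X → Y → ℝ) (g : X → Y) (R : ℝ≥0∞), ENNReal.ofReal
        (risk D L g - (m : ℝ)⁻¹ * ∑ i, marginLoss L b ρ 1 f (S i)) ≤
        R + ENNReal.ofReal (slack ρ (maxLoss L) δ (Fintype.card Y) m p) := by
    intro hle S f g R
    refine (ENNReal.ofReal_le_ofReal ?_).trans le_add_self
    linarith [risk_le_maxLoss D hL g, average_marginLoss_nonneg hL b ρ 1 f S]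
  by_cases hp : 1 ≤ p
  · have hcase : maxLoss L ≤ slack ρ (maxLoss L) δ (Fintype.card Y) m p ∨
        0 < maxLoss L ∧ ∃ n : ℕ, 1 ≤ n ∧ maxLoss L *
          √((n * Real.log p + Real.log (1 / (δ / 2))) / (2 * m)) +
          maxLoss L * (Fintype.card Y * Real.exp (-(n * ρ ^ 2 / 8))) ≤
            slack ρ (maxLoss L) δ (Fintype.card Y) m p := by
      rcases hM0.eq_or_lt with h0 | hM
      · left
        rwa [← h0] at hs0 ⊢
      · exact (exists_le_slack hρ hM hδ hδ1 (Fintype.card_pos_iff.2 ⟨z₀.2⟩) hm hp).imp_right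
          fun h => ⟨hM, h⟩
    rcases hcase with hle | ⟨hM, n, hn, hle⟩
    · refine le_of_eq_of_le ?_ (zero_le)
      convert measure_empty (μ := sampleLaw D m)
      exact Set.eq_empty_of_forall_notMem fun S hS => hS fun T α k h g _ _ _ _ => htriv hle S _ g _
    · refine (measure_mono ?_).trans (measure_exists_deviation_union_le D hL hM (b := b) hB
        (fun y y' => by rw [abs_of_nonneg (hb _ _)]; exact hbB _ _) ρ (1 / 2) hm hp H hHm hHe
        (half_pos hδ) (by linarith) n)
      intro S hS
      by_contra hbad
      refine hS fun T α k h g hα hα1 hh hg => ?_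
      refine (ofReal_risk_sub_le D hL hb B hρ hm hn hHm hH hα hα1 hh hg
        (Q := maxLoss L * √((n * Real.log p + Real.log (1 / (δ / 2))) / (2 * m)))
        (by positivity) fun κ w hw => ?_).trans (add_le_add_right (ENNReal.ofReal_le_ofReal hle) _)
      by_contra hlt
      exact hbad ⟨κ, w, hw, not_le.1 hlt⟩
  · refine le_of_eq_of_le ?_ (zero_le)
    convert measure_empty (μ := sampleLaw D m)
    exact Set.eq_empty_of_forall_notMem fun S hS =>
      hS fun T α k h g _ hα1 _ _ => absurd (hp_of hα1 k) hp

end VRM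

theorem theorem3 {X Y : Type*} [MeasurableSpace X] [MeasurableSpace Y]
    [Fintype Y] [MeasurableSingletonClass Y]
    (D : Measure (X × Y)) [IsProbabilityMeasure D]
    (L : Y → Y → ℝ) (hL : VRM.IsLoss L)
    (G : X × Y → VRM.OutputGraph Y)
    (m : ℕ) (hm : 1 ≤ m) (p : ℕ) (H : Fin p → Set (VRM.ScoringFunction G))
    (hH_meas : ∀ k, VRM.PointwiseMeasurable (H k))
    (hH_emp : ∀ k, AEMeasurable
      (fun S : Fin m → X × Y => VRM.empComplexity (H k) S) (VRM.sampleLaw D m))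
    (hH_range : ∀ k, ∀ h ∈ H k, ∀ x y y', |h.score x y - h.score x y'| ≤ 1)
    (ρ : ℝ) (hρ : 0 < ρ) (δ : ℝ) (hδ : 0 < δ) :
    VRM.sampleLaw D m {S | ¬ ∀ (T : ℕ) (α : Fin T → ℝ) (k : Fin T → Fin p)
        (h : Fin T → VRM.ScoringFunction G) (g : X → Y),
        (∀ t, 0 ≤ α t) → ∑ t, α t = 1 → (∀ t, h t ∈ H (k t)) →
        VRM.IsPredictor (VRM.ensemble α h) g →
        ENNReal.ofReal (VRM.risk D L g - VRM.empAddLoss L ρ 1 S (VRM.ensemble α h)) ≤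
            ENNReal.ofReal (4 * √2 / ρ) *
                ∑ t, ENNReal.ofReal (α t) * VRM.complexity D m (H (k t)) +
              ENNReal.ofReal (VRM.slack ρ (VRM.maxLoss L) δ (Fintype.card Y) m p) ∧
        ENNReal.ofReal (VRM.risk D L g - VRM.empMultLoss L ρ 1 S (VRM.ensemble α h)) ≤
            ENNReal.ofReal (4 * √2 * VRM.maxLoss L / ρ) *
                ∑ t, ENNReal.ofReal (α t) * VRM.complexity D m (H (k t)) +
              ENNReal.ofReal (VRM.slack ρ (VRM.maxLoss L) δ (Fintype.card Y) m p)}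
      ≤ ENNReal.ofReal δ := by
  rcases le_or_gt 1 δ with hδ1 | hδ1
  · exact prob_le_one.trans (ENNReal.one_le_ofReal.2 hδ1)
  -- Both margin losses are instances of one weighted loss, with weight bounds `1 / ρ` and `M / ρ`.
  -- Each instance spends half of the confidence, which is the source of `log (2 / δ)`.
  have hadd := VRM.measure_not_risk_sub_le D hL (b := fun _ _ => 1 / ρ) (B := 1 / ρ)
    (fun _ _ => by positivity) (fun _ _ => le_rfl) hm H hH_meas hH_emp hH_range hρ hδ hδ1
  have hmult := VRM.measure_not_risk_sub_le D hL (b := fun y y' => L y y' / ρ)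
    (B := VRM.maxLoss L / ρ) (fun y y' => div_nonneg (hL.nonneg _ _) hρ.le)
    (fun y y' => by gcongr; exact VRM.le_maxLoss L y y') hm H hH_meas hH_emp hH_range hρ hδ hδ1
  refine le_trans ((measure_mono fun S hS => ?_).trans
    (measure_union_le _ _)) ((add_le_add hadd hmult).trans_eq ?_)
  · by_contra hcon
    rw [Set.mem_union, not_or] at hcon
    obtain ⟨h1, h2⟩ := hcon
    refine hS fun T α k h g hα hα1 hh hg => ⟨?_, ?_⟩
    · rw [VRM.empAddLoss_eq L hρ, div_eq_mul_one_div (4 * √2)]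
      exact not_not.1 h1 T α k h g hα hα1 hh hg
    · rw [VRM.empMultLoss_eq L hρ, mul_div_assoc]
      exact not_not.1 h2 T α k h g hα hα1 hh hg
  · rw [← ENNReal.ofReal_add (by positivity) (by positivity), add_halves]
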